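/- **Model.** Let $\mathcal X\subset\mathbb R^{d_0}$, $B,L,B_\epsilon>0$, let $\mathcal V$ be a class of functions $\mathcal X\to\mathbb R$, and let $v^*\in\mathcal V$ (realizability) be measurable with $v^*(x)\in[B_\epsilon,B-B_\epsilon]$ for all $x\in\mathcal X$. Contexts $x_t$ are i.i.d. on $\mathcal X$ with an arbitrary law $\mu_X$; noises $\epsilon_t$ are i.i.d., have mean zero, satisfy $|\epsilon_t|\le B_\epsilon$ almost surely, are independent of the contexts and of the seller's randomization, and have a distribution function $F$ with $|F(a)-F(b)|\le L|a-b|$ for all $a,b\in\mathbb R$. In round $t=1,2,\dots$ the seller sees $x_t$, posts a price $p_t$ using only past contexts, prices and sale outcomes, $x_t$, and its own randomization, and sees $y_t=\mathbb 1\{p_t\le v^*(x_t)+\epsilon_t\}$. With $\mathsf{Rev}_t(p)=p\,(1-F(p-v^*(x_t)))$ and $p_t^*\in\arg\max_{p\ge0}\mathsf{Rev}_t(p)$, the regret is $\mathrm{Reg}(T)=\sum_{t=1}^T(\mathsf{Rev}_t(p_t^*)-\mathsf{Rev}_t(p_t))$. **Oracle.** There is an offline regression oracle with complexity $\rho_{\mathcal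 V}(\cdot)$: for all $\delta\in(0,1)$ and $n\ge1$ it maps $n$ samples (context, binary label) to some $\hat v\in\mathcal V$ (measurably, also in sup-norm), and if the samples are i.i.d. with context law $\mu_X$ and $\mathbb E[By\mid x]=v^*(x)$, then $\sup_{x\in\mathcal X}|\hat v(x)-v^*(x)|\le\sqrt{\rho_{\mathcal V}(\delta)/n}$ with probability at least $1-\delta$. **Algorithm** (inputs $B$, $\delta$, $\rho=\rho_{\mathcal V}(\delta)$ and the oracle; neither $L$, $B_\epsilon$ nor $T$ is used). Let $k^*=\lceil\log_2\rho\rceil$. In the warm-up rounds $t\le 2^{k^*-1}$ (at least in round $1$) post $p_t\sim\mathrm{Unif}(0,B)$, independently of everything else. Episode $k$ consists of the $\ell_k=2^{k-1}$ rounds $2^{k-1}<t\le2^k$. Its first $T_k^e=\min\{\ell_k,\lceil\ell_k^{2/3}\rho^{1/3}\rceil\}$ rounds also use $p_t\sim\mathrm{Unif}(0,B)$, and the oracle at confidence $\delta$ computes $\hat v_k$ from the pairs $(x_t,y_t)$ of these rounds. The remaining $T_k=\ell_k-T_k^e$ rounds of episodes $k\ge k^*$ use UCB-LDP, with $N_k=\lceil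 T_k^{1/3}/\ln^{1/3}(T_k/\delta)\rceil$ and $S_k=\max\{1,\lceil\frac12\log_2T_k\rceil\}$: let $m_1,\dots,m_{N_k}$ be the midpoints of the $N_k$ equal parts of $[-\|\hat v_k\|_\infty,B+\|\hat v_k\|_\infty]$. In round $t$, for a layer $s\le S_k$ and an index $j$ let $\Psi_t^s(j)$ be the set of earlier UCB rounds of the episode with stopping layer $s$ and index $j$, $w_{t,s}^j$ the mean of $y_\tau$ over $\tau\in\Psi_t^s(j)$ ($0$ if this set is empty), $r_{t,s}^j=\min\{\sqrt{2\ln(2S_kN_kT_k/\delta)/|\Psi_t^s(j)|},1\}$ ($1$ if it is empty), and $\mathrm{UCB}_{t,s}^j=(m_j+\hat v_k(x_t))(w_{t,s}^j+r_{t,s}^j)$. Start with $s=1$ and $\mathcal A_{t,1}=\{j:m_j+\hat v_k(x_t)\in(0,B)\}$. If $s<S_k$ and some $j\in\mathcal A_{t,s}$ has $(m_j+\hat v_k(x_t))r_{t,s}^j>B2^{-s}$, stop at layer $s$ with an arbitrary such $j_t=j$. If $s<S_k$ and there is no such $j$, put $\mathcal A_{t,s+1}=\{j\in\mathcal A_{t,s}:\mathrm{UCB}_{t,s}^j\ge\max_{j'\in\mathcal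 A_{t,s}}\mathrm{UCB}_{t,s}^{j'}-B2^{1-s}\}$ and continue with $s+1$. If $s=S_k$, stop with $j_t\in\arg\max_{j\in\mathcal A_{t,s}}\mathrm{UCB}_{t,s}^j$ (any $j_t\in\{1,\dots,N_k\}$ if $\mathcal A_{t,s}$ is empty). Post $p_t=m_{j_t}+\hat v_k(x_t)$. Arbitrary choices and ties may be resolved by any rule using only what the seller knows. **Theorem.** There is a universal $m\in\mathbb N$, and for all $B,L>0$ a constant $C>0$ depending only on $B$ and $L$, such that in every such model, for every $T\ge2$ and every $0<\delta<1/(2\lceil\log_2T\rceil)$ with $\rho_{\mathcal V}(\delta)\ge1$, the algorithm satisfies $$\mathrm{Reg}(T)\le C\,\ln^m(T/\delta)\;\rho_{\mathcal V}(\delta)^{1/3}\,T^{2/3}\quad\text{with probability at least }1-2\delta\lceil\log_2T\rceil .$$ -/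

import Mathlib

open MeasureTheory ProbabilityTheory

noncomputable section

namespace DynPricing

/-! ### The layered UCB selection in one round

`price j` is the candidate price of the grid index `j`, `cnt s j` the number of earlier rounds of
the current UCB phase that stopped at layer `s` with index `j`, and `avg s j` the mean of their
sale outcomes (`0` if there is none). -/

/-- Everything that the layer traversal of one round looks at. -/
structure RoundData where
  /-- price bound -/
  B : ℝ
  /-- confidence parameter -/
  δ : ℝ
  /-- number of grid points -/
  N : ℕ
  /-- number of layers -/
  S : ℕ
  /-- length of the UCB phase -/
  len : ℕ
  /-- candidate prices -/
  price : ℕ → ℝ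
  /-- number of samples of an index in a layer -/
  cnt : ℕ → ℕ → ℕ
  /-- sample mean of an index in a layer -/
  avg : ℕ → ℕ → ℝ

namespace RoundData

variable (R : RoundData)

/-- Confidence radius `min {√(2 ln(2 S N T / δ) / n), 1}`, which is `1` when `n = 0`. -/
def radius (s j : ℕ) : ℝ :=
  if R.cnt s j = 0 then 1
  else min (Real.sqrt (2 * Real.log (2 * R.S * R.N * R.len / R.δ) / R.cnt s j)) 1

/-- Upper confidence bound on the revenue. -/
def ucb (s j : ℕ) : ℝ := R.price j * (R.avg s j + R.radius s j)

open Classical in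
/-- The candidate indices at layer `s` (layers are numbered from `1`): first all indices whose
price lies in `(0, B)`; in each step only those survive whose upper confidence bound is within
`B * 2 ^ (1 - s)` of the largest one. -/
def active : ℕ → Finset ℕ
  | 0 => (Finset.Icc 1 R.N).filter fun j => 0 < R.price j ∧ R.price j < R.B
  | 1 => (Finset.Icc 1 R.N).filter fun j => 0 < R.price j ∧ R.price j < R.B
  | s + 2 => (active (s + 1)).filter fun j =>
      ∀ j' ∈ active (s + 1),
        R.ucb (s + 1) j' - R.B * (2 : ℝ) ^ (1 - ((s + 1 : ℕ) : ℤ)) ≤ R.ucb (s + 1) j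

/-- Index `j` violates the statistical precision check at layer `s`. -/
def Fails (s j : ℕ) : Prop :=
  j ∈ R.active s ∧ R.B * (2 : ℝ) ^ (-(s : ℤ)) < R.price j * R.radius s j

/-- `R.Selects s j`: the layer traversal may stop at layer `s` with index `j`.
All layers before `s` pass the check. If `s < S`, then `j` is any index that fails the check at `s`.
If `s = S`, then `j` is any maximiser of the upper confidence bound over the remaining indices
(any grid index at all, if no candidate price lies in `(0, B)`). -/
def Selects (s j : ℕ) : Prop :=
  1 ≤ s ∧ s ≤ R.S ∧ (∀ s', 1 ≤ s' → s' < s → ∀ i, ¬ R.Fails s' i) ∧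
    (s < R.S → R.Fails s j) ∧
    (s = R.S →
      (j ∈ R.active s ∧ ∀ i ∈ R.active s, R.ucb s i ≤ R.ucb s j) ∨
      (R.active s = ∅ ∧ j ∈ Finset.Icc 1 R.N))

end RoundData

/-! ### The whole algorithm -/

/-- What the seller feeds into the algorithm: the price bound `B`, the confidence parameter `δ`,
the statistical complexity `ρ` at this confidence, and the offline regression oracle at this
confidence, which turns `n` samples (context, sale) into a predictor. -/
structure AlgInput (X : Type*) where
  B : ℝ
  δ : ℝ
  ρ : ℝ
  oracle : (n : ℕ) → (Fin n → X × Bool) → X → ℝ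

/-- One realisation of the interaction; rounds are numbered from `1`. -/
structure Trajectory (X : Type*) where
  /-- context of a round -/
  ctx : ℕ → X
  /-- auxiliary draw of the seller in a round, the price posted when exploring -/
  unif : ℕ → ℝ
  /-- posted price -/
  price : ℕ → ℝ
  /-- whether a sale occurs -/
  sale : ℕ → Bool
  /-- stopping layer (in UCB rounds) -/
  layer : ℕ → ℕ
  /-- selected grid index (in UCB rounds) -/
  arm : ℕ → ℕ

/-- The value `0` or `1` of a sale outcome. -/
def ind (b : Bool) : ℝ := if b then 1 else 0

namespace AlgInput

variable {X : Type*} (A : AlgInput X)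

/-- First episode `k* = ⌈log₂ ρ⌉` after the warm-up. -/
def kStar : ℕ := ⌈Real.logb 2 A.ρ⌉₊

/-- The episode of round `t ≥ 2`: the `k` with `2 ^ (k - 1) < t ≤ 2 ^ k`. -/
def episode (t : ℕ) : ℕ := Nat.clog 2 t

/-- Length `ℓ_k = 2 ^ (k - 1)` of episode `k ≥ 1`. -/
def ell (k : ℕ) : ℕ := 2 ^ (k - 1)

/-- Length of the exploration phase of episode `k`, capped by the length of the episode. -/
def expLen (k : ℕ) : ℕ :=
  min (ell k) ⌈((ell k : ℕ) : ℝ) ^ (2 / 3 : ℝ) * A.ρ ^ (1 / 3 : ℝ)⌉₊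

/-- Length of the UCB phase of episode `k`. -/
def ucbLen (k : ℕ) : ℕ := ell k - A.expLen k

/-- Last exploration round of episode `k`. -/
def expEnd (k : ℕ) : ℕ := 2 ^ (k - 1) + A.expLen k

/-- Number of grid points in episode `k`. -/
def gridSize (k : ℕ) : ℕ :=
  ⌈((A.ucbLen k : ℕ) : ℝ) ^ (1 / 3 : ℝ) / Real.log (A.ucbLen k / A.δ) ^ (1 / 3 : ℝ)⌉₊

/-- Number of layers in episode `k` (at least one). -/
def numLayers (k : ℕ) : ℕ := max 1 ⌈(1 / 2 : ℝ) * Real.logb 2 (A.ucbLen k)⌉₊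

/-- Round `t` comes after the warm-up and after the exploration phase of its episode. -/
def InUCB (t : ℕ) : Prop := 2 ^ (A.kStar - 1) < t ∧ A.expEnd (episode t) < t

/-- The predictor of episode `k`, computed from the exploration samples of this episode. -/
def vHat (tr : Trajectory X) (k : ℕ) : X → ℝ :=
  A.oracle (A.expLen k) fun i =>
    (tr.ctx (2 ^ (k - 1) + 1 + i), tr.sale (2 ^ (k - 1) + 1 + i))

/-- Sup-norm of the predictor. -/
def vNorm (tr : Trajectory X) (k : ℕ) : ℝ := ⨆ x, |A.vHat tr k x|

/-- Midpoint of the `j`-th (`1 ≤ j ≤ N`) of the `N` equal parts of `[-‖v̂‖, B + ‖v̂‖]`. -/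
def midpoint (tr : Trajectory X) (k j : ℕ) : ℝ :=
  -A.vNorm tr k + ((j : ℝ) - 1 / 2) * ((A.B + 2 * A.vNorm tr k) / A.gridSize k)

/-- The candidate price of index `j` in round `t`. -/
def candPrice (tr : Trajectory X) (t j : ℕ) : ℝ :=
  A.midpoint tr (episode t) j + A.vHat tr (episode t) (tr.ctx t)

/-- The earlier UCB rounds of the episode of `t` that stopped at layer `s` with index `j`.
The midpoints being distinct, these are the rounds of layer `s` that posted the price of `j`. -/
def samples (tr : Trajectory X) (t s j : ℕ) : Finset ℕ :=
  (Finset.Ioo (A.expEnd (episode t)) t).filter fun τ => tr.layer τ = s ∧ tr.arm τ = j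

/-- The data for the layer traversal of round `t`. -/
def roundData (tr : Trajectory X) (t : ℕ) : RoundData where
  B := A.B
  δ := A.δ
  N := A.gridSize (episode t)
  S := A.numLayers (episode t)
  len := A.ucbLen (episode t)
  price := A.candPrice tr t
  cnt := fun s j => (A.samples tr t s j).card
  avg := fun s j => (∑ τ ∈ A.samples tr t s j, ind (tr.sale τ)) / (A.samples tr t s j).card

/-- The trajectory is produced by the algorithm: in warm-up and exploration rounds the auxiliary
draw is posted; in UCB rounds the layer traversal determines layer, index and price. -/
def IsRun (tr : Trajectory X) : Prop :=
  ∀ t, 1 ≤ t →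
    (¬ A.InUCB t → tr.price t = tr.unif t) ∧
    (A.InUCB t → (A.roundData tr t).Selects (tr.layer t) (tr.arm t) ∧
      tr.price t = A.candPrice tr t (tr.arm t))

end AlgInput

/-! ### The stochastic model -/

/-- What the seller knows when pricing in round `t`: contexts and auxiliary draws of the rounds
`1, …, t` and prices and sale outcomes of the rounds `1, …, t - 1`. -/
@[reducible] def sellerInfo {Ω X : Type*} [MeasurableSpace X] (tr : Ω → Trajectory X) (t : ℕ) :
    MeasurableSpace Ω :=
  (⨆ i ∈ Set.Icc 1 t, MeasurableSpace.comap (fun ω => ((tr ω).ctx i, (tr ω).unif i)) inferInstance) ⊔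
  (⨆ i ∈ Set.Ico 1 t, MeasurableSpace.comap (fun ω => ((tr ω).price i, (tr ω).sale i)) inferInstance)

/-- The contextual pricing model with context law `μX`, noise law `ν`, valuation function `vstar`
and noise variables `ε`, in which the seller draws from the uniform law on `(0, B)`: the triples
(context, noise, auxiliary draw) are i.i.d. with independent components, a sale occurs exactly
when the valuation is at least the price, and the seller's choices use only what the seller knows. -/
structure IsPricingModel {Ω X : Type*} [MeasurableSpace Ω] [MeasurableSpace X] (P : Measure Ω)
    (B : ℝ) (μX : Measure X) (ν : Measure ℝ) (vstar : X → ℝ) (ε : ℕ → Ω → ℝ)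
    (tr : Ω → Trajectory X) : Prop where
  meas_ctx : ∀ t, Measurable fun ω => (tr ω).ctx t
  meas_noise : ∀ t, Measurable (ε t)
  meas_unif : ∀ t, Measurable fun ω => (tr ω).unif t
  law : ∀ t, P.map (fun ω => ((tr ω).ctx t, ε t ω, (tr ω).unif t)) =
    μX.prod (ν.prod (ProbabilityTheory.cond volume (Set.Ioo 0 B)))
  indep : iIndepFun (fun t ω => ((tr ω).ctx t, ε t ω, (tr ω).unif t)) P
  sale_iff : ∀ t ω, (tr ω).sale t = true ↔ (tr ω).price t ≤ vstar ((tr ω).ctx t) + ε t ω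
  nonanticipating : ∀ t, 1 ≤ t → Measurable[sellerInfo tr t] fun ω => (tr ω).arm t

/-- Expected revenue of price `p` at a context with mean valuation `v`. -/
def rev (F : ℝ → ℝ) (v p : ℝ) : ℝ := p * (1 - F (p - v))

/-- Offline regression oracle for the class `𝒱` with complexity `ρ`, for contexts with law `μX` and
valuation function `vstar`: for every confidence `δ` and sample size `n`, its predictors lie in `𝒱`,
and on `n` i.i.d. samples of any law of (context, binary label `y`) with `E[B y | x] = vstar x`
the sup-norm error exceeds `√(ρ δ / n)` with probability at most `δ`. -/
def IsOfflineRegressionOracle {X : Type*} [MeasurableSpace X] (B : ℝ) (μX : Measure X)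
    (vstar : X → ℝ) (𝒱 : Set (X → ℝ)) (ρ : ℝ → ℝ)
    (oracle : ℝ → (n : ℕ) → (Fin n → X × Bool) → X → ℝ) : Prop :=
  ∀ δ, 0 < δ → δ < 1 → ∀ n, 0 < n →
    (∀ data, oracle δ n data ∈ 𝒱) ∧
    ∀ D : Measure (X × Bool), IsProbabilityMeasure D → D.map Prod.fst = μX →
      D[fun z => B * ind z.2 | MeasurableSpace.comap Prod.fst inferInstance]
        =ᵐ[D] (fun z => vstar z.1) →
      Measure.pi (fun _ : Fin n => D)
        {data | ¬ ∀ x, |oracle δ n data x - vstar x| ≤ Real.sqrt (ρ δ / n)} ≤ ENNReal.ofReal δ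

/-- Measurability of an oracle: the prediction and the sup-norm of the predictor. -/
def OracleMeasurable {X : Type*} [MeasurableSpace X]
    (oracle : ℝ → (n : ℕ) → (Fin n → X × Bool) → X → ℝ) : Prop :=
  ∀ δ n, Measurable (fun z : (Fin n → X × Bool) × X => oracle δ n z.1 z.2) ∧
    Measurable fun data : Fin n → X × Bool => ⨆ x, |oracle δ n data x|

end DynPricing

end

/-! In a UCB round, index `j` posts `m_j + v̂(x)`, which sells with probability `1 - F(m_j + v̂(x) -
v*(x))`. By the Lipschitz condition this is within `L‖v̂ - v*‖` of `θ_j = 1 - F(m_j)`, which does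
not depend on the context. Each episode is thus a bandit problem with arm means `θ_j`, known
context-dependent weights (the prices) and a bias `e = L · (prediction error)`, and sales made in
different contexts can be pooled per arm.

The deterministic half assumes that all sample means are correct up to radius plus bias. Elimination
at a layer then costs the best surviving index at most `2Be` (`exists_mem_active_succ`), so an index
chosen at layer `s` has regret `O(B 2^{-s} + B e s)` (`sub_le_of_selects`). An index can stop the
traversal at a layer `s < S` only `O(4^s log)` times, and `4^S` exceeds the length of the phase;
hence the sum of `2^{-s}` over the phase is at most `S √(len · N · log)` up to constants
(`sum_two_zpow_layer_le`). Discretisation adds `O(1/N)` per round (`Concentrated.regret_le`).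

The probabilistic half consists of two events per episode, each failing with probability at most
`δ`. Given everything before the noise of a round, the sale is a Bernoulli variable with mean
`demand`, so Hoeffding's lemma gives exponential supermartingales and a union bound gives
`measure_not_concentrated_le`. A uniform price makes `B y` an unbiased label for `v*`, so the oracle
guarantee applies to the exploration samples (`measure_not_predictor_le`).

Finally, `ℓ^{2/3} ρ^{1/3}` exploration rounds give prediction error `(ρ/ℓ)^{1/3}`; with `N ≈
ℓ^{1/3}` every contribution is `ρ^{1/3} T^{2/3}` up to logarithms, and there are only `⌈log₂ T⌉`
episodes. -/

namespace DynPricing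

/-! ### Deterministic analysis of the layered elimination in one round -/

namespace RoundData

variable {R : RoundData}

theorem active_subset_active_one (s : ℕ) : R.active s ⊆ R.active 1 := by
  induction s with
  | zero => exact fun j hj => hj
  | succ s ih =>
    cases s with
    | zero => exact fun j hj => hj
    | succ s =>
      intro j hj
      simp only [active, Finset.mem_filter] at hj
      exact ih hj.1

theorem mem_active_one {j : ℕ} :
    j ∈ R.active 1 ↔ j ∈ Finset.Icc 1 R.N ∧ 0 < R.price j ∧ R.price j < R.B := by
  rw [active, Finset.mem_filter]

theorem mem_active_succ {s j : ℕ} (hs : 1 ≤ s) :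
    j ∈ R.active (s + 1) ↔ j ∈ R.active s ∧ ∀ j' ∈ R.active s,
      R.ucb s j' - R.B * (2 : ℝ) ^ (1 - (s : ℤ)) ≤ R.ucb s j := by
  obtain ⟨s, rfl⟩ : ∃ r, s = r + 1 := ⟨s - 1, by omega⟩
  simp only [active, Finset.mem_filter]

theorem radius_nonneg (s j : ℕ) : 0 ≤ R.radius s j := by
  unfold radius
  split_ifs
  · exact zero_le_one
  · exact le_min (Real.sqrt_nonneg _) zero_le_one

/-- The sample means of all layers estimate `θ` up to the confidence radius and a bias `e`. -/
def Accurate (R : RoundData) (θ : ℕ → ℝ) (e : ℝ) : Prop :=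
  ∀ s, 1 ≤ s → s ≤ R.S → ∀ j ∈ Finset.Icc 1 R.N, |R.avg s j - θ j| ≤ R.radius s j + e

variable {θ : ℕ → ℝ} {e : ℝ}

theorem Accurate.le_ucb (h : R.Accurate θ e) (he : 0 ≤ e) {s j r : ℕ} (h1 : 1 ≤ s) (hS : s ≤ R.S)
    (hj : j ∈ R.active r) : R.price j * θ j - R.B * e ≤ R.ucb s j := by
  obtain ⟨hN, h0, hB⟩ := mem_active_one.1 (active_subset_active_one r hj)
  have := (abs_le.1 (h s h1 hS j hN)).1
  have h2 : R.price j * (θ j - e) ≤ R.price j * (R.avg s j + R.radius s j) :=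
    mul_le_mul_of_nonneg_left (by linarith) h0.le
  have h3 : R.price j * e ≤ R.B * e := mul_le_mul_of_nonneg_right hB.le he
  unfold ucb
  linarith

/-- Passing the check bounds price times radius by `B 2^{-s}`. The radius enters twice, as the
optimism bonus and as the estimation error of the mean. -/
theorem Accurate.ucb_le (h : R.Accurate θ e) (he : 0 ≤ e) {s j : ℕ} (h1 : 1 ≤ s) (hS : s ≤ R.S)
    (hj : j ∈ R.active s) (hf : ¬ R.Fails s j) :
    R.ucb s j ≤ R.price j * θ j + 2 * (R.B * (2 : ℝ) ^ (-(s : ℤ))) + R.B * e := by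
  obtain ⟨hN, h0, hB⟩ := mem_active_one.1 (active_subset_active_one s hj)
  have := (abs_le.1 (h s h1 hS j hN)).2
  have h2 : R.price j * (R.avg s j + R.radius s j) ≤ R.price j * (θ j + 2 * R.radius s j + e) :=
    mul_le_mul_of_nonneg_left (by linarith) h0.le
  have h3 : R.price j * e ≤ R.B * e := mul_le_mul_of_nonneg_right hB.le he
  have h4 : R.price j * R.radius s j ≤ R.B * (2 : ℝ) ^ (-(s : ℤ)) := by
    by_contra hc
    exact hf ⟨hj, not_le.1 hc⟩
  unfold ucb
  linarith

theorem two_zpow_one_sub (s : ℕ) : (2 : ℝ) ^ (1 - (s : ℤ)) = 2 * (2 : ℝ) ^ (-(s : ℤ)) := by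
  rw [sub_eq_add_neg, zpow_add₀ two_ne_zero, zpow_one]

/-- If `j` is eliminated, the index of largest upper bound replaces it: the elimination margin `B
2^{1-s}` equals the slack `2 B 2^{-s}` of that upper bound, so only the bias is lost, once for each
of the two indices. -/
theorem Accurate.exists_mem_active_succ (h : R.Accurate θ e) (he : 0 ≤ e) {s j : ℕ} (h1 : 1 ≤ s)
    (hS : s ≤ R.S) (hj : j ∈ R.active s) (hf : ∀ i, ¬ R.Fails s i) :
    ∃ i ∈ R.active (s + 1), R.price j * θ j - 2 * (R.B * e) ≤ R.price i * θ i := by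
  have hBe : 0 ≤ R.B * e := by
    obtain ⟨-, h0, hB⟩ := mem_active_one.1 (active_subset_active_one s hj)
    exact mul_nonneg (h0.trans hB).le he
  by_cases hj' : j ∈ R.active (s + 1)
  · exact ⟨j, hj', by linarith⟩
  · obtain ⟨i, hi, hmax⟩ := Finset.exists_max_image (R.active s) (R.ucb s) ⟨j, hj⟩
    have hBs : 0 ≤ R.B * (2 : ℝ) ^ (1 - (s : ℤ)) := by
      obtain ⟨-, h0, hB⟩ := mem_active_one.1 (active_subset_active_one s hj)
      exact mul_nonneg (h0.trans hB).le (by positivity)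
    refine ⟨i, (mem_active_succ h1).2 ⟨hi, fun j' hj' => by linarith [hmax j' hj']⟩, ?_⟩
    rw [mem_active_succ h1] at hj'
    push Not at hj'
    obtain ⟨i', hi', hlt⟩ := hj' hj
    have := hmax i' hi'
    have h2 := h.le_ucb he h1 hS hj
    have h3 := h.ucb_le he h1 hS hi (hf i)
    rw [two_zpow_one_sub] at hlt
    linarith

theorem Accurate.exists_mem_active (h : R.Accurate θ e) (he : 0 ≤ e) {j : ℕ}
    (hj : j ∈ R.active 1) {s : ℕ} (h1 : 1 ≤ s) (hS : s ≤ R.S)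
    (hf : ∀ s', 1 ≤ s' → s' < s → ∀ i, ¬ R.Fails s' i) :
    ∃ i ∈ R.active s, R.price j * θ j - 2 * (R.B * e) * (s - 1) ≤ R.price i * θ i := by
  induction s, h1 using Nat.le_induction with
  | base => exact ⟨j, hj, by simp⟩
  | succ s h1 ih =>
    obtain ⟨i, hi, hle⟩ := ih (by omega) fun s' h h' => hf s' h (by omega)
    obtain ⟨i', hi', hle'⟩ := h.exists_mem_active_succ he h1 (by omega) hi (hf s h1 (by omega))
    refine ⟨i', hi', ?_⟩
    push_cast
    linarith

/-- Regret of the selected index against any candidate index. -/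
theorem Accurate.sub_le_of_selects (h : R.Accurate θ e) (he : 0 ≤ e) (hθ : ∀ j, θ j ∈ Set.Icc 0 1)
    {j₀ s j : ℕ} (hj₀ : j₀ ∈ R.active 1) (hsel : R.Selects s j) :
    j ∈ R.active 1 ∧
    R.price j₀ * θ j₀ - R.price j * θ j ≤
      8 * R.B * (2 : ℝ) ^ (-(s : ℤ)) + 2 * (R.B * e) * s := by
  obtain ⟨h1, hS, hf, hlt, heq⟩ := hsel
  -- A survivor at layer `s` rules out the fallback of an empty candidate set.
  obtain ⟨i₀, hi₀, -⟩ := h.exists_mem_active he hj₀ h1 hS hf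
  have hj : j ∈ R.active s := by
    rcases hS.lt_or_eq with hs | hs
    · exact (hlt hs).1
    · rcases heq hs with h' | h'
      · exact h'.1
      · rw [h'.1] at hi₀
        simp at hi₀
  refine ⟨active_subset_active_one s hj, ?_⟩
  obtain ⟨-, hp0, hpB⟩ := mem_active_one.1 (active_subset_active_one s hj)
  have hB : 0 < R.B := hp0.trans hpB
  have hBe : 0 ≤ R.B * e := mul_nonneg hB.le he
  -- Layer 1 has no previous elimination to exploit; there the trivial bound `B` is below `8 B
  -- 2^{-1}`.
  rcases h1.eq_or_lt with rfl | h1'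
  · obtain ⟨-, hq0, hqB⟩ := mem_active_one.1 hj₀
    have h2 : R.price j₀ * θ j₀ ≤ R.B * 1 :=
      mul_le_mul hqB.le (hθ j₀).2 (hθ j₀).1 hB.le
    have h3 : 0 ≤ R.price j * θ j := mul_nonneg hp0.le (hθ j).1
    norm_num
    linarith
  -- Only survival of the elimination at layer `r = s - 1` matters, whether or not `s` is the last
  -- layer: margin plus slack is `4 B 2^{-r} = 8 B 2^{-s}`.
  · obtain ⟨r, rfl⟩ : ∃ r, s = r + 1 := ⟨s - 1, by omega⟩
    have hr : 1 ≤ r := by omega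
    obtain ⟨i, hi, hle⟩ := h.exists_mem_active he hj₀ hr (by omega)
      fun s' h h' => hf s' h (by omega)
    obtain ⟨hjr, hj'⟩ := (mem_active_succ hr).1 hj
    have h2 := hj' i hi
    have h3 := h.le_ucb he hr (by omega) hi
    have h4 := h.ucb_le he hr (by omega) hjr (hf r hr (by omega) j)
    rw [two_zpow_one_sub] at h2
    have h5 : (2 : ℝ) ^ (-(r : ℤ)) = 2 * (2 : ℝ) ^ (-((r + 1 : ℕ) : ℤ)) := by
      rw [← two_zpow_one_sub]
      congr 1
      push_cast
      ring
    rw [h5] at h2 h4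
    push_cast at h2 h4 ⊢
    nlinarith

/-- Since the price is below `B`, failure forces the radius above `2^{-s}`, and the radius is at
most of order `1 / √cnt`. The absolute value avoids a sign condition on the logarithm. -/
theorem Fails.cnt_lt {s j : ℕ} (h : R.Fails s j) :
    (R.cnt s j : ℝ) ≤ |2 * Real.log (2 * R.S * R.N * R.len / R.δ)| * 4 ^ s := by
  obtain ⟨hj, hlt⟩ := h
  obtain ⟨-, h0, hB⟩ := mem_active_one.1 (active_subset_active_one s hj)
  set b := 2 * Real.log (2 * R.S * R.N * R.len / R.δ) with hb
  have h1 : (2 : ℝ) ^ (-(s : ℤ)) < R.radius s j := by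
    by_contra hc
    have : R.price j * R.radius s j ≤ R.B * (2 : ℝ) ^ (-(s : ℤ)) :=
      mul_le_mul hB.le (not_lt.1 hc) (radius_nonneg s j) (h0.trans hB).le
    linarith
  rcases Nat.eq_zero_or_pos (R.cnt s j) with hc | hc
  · rw [hc]
    simp only [Nat.cast_zero]
    positivity
  · have hc' : (0 : ℝ) < R.cnt s j := by exact_mod_cast hc
    rw [radius, if_neg hc.ne', ← hb] at h1
    have h2 := h1.trans_le (min_le_left _ _)
    rw [Real.lt_sqrt (by positivity), lt_div_iff₀ hc', zpow_neg, zpow_natCast, inv_pow, ← pow_mul,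
      mul_comm s 2, pow_mul, inv_mul_lt_iff₀ (by positivity)] at h2
    norm_num at h2
    nlinarith [le_abs_self b, pow_pos (show (0 : ℝ) < 4 by norm_num) s]

end RoundData

/-- A grid of step `h` from at most `h / 2` to at least `B - h / 2` has a point just below each
`p ∈ [h, B)`. -/
theorem exists_grid_point {N : ℕ} (hN : 0 < N) {a h B p : ℝ} (ha : a ≤ 0)
    (hB : B ≤ a + N * h) (hp : h ≤ p) (hpB : p < B) (h0 : 0 < h) :
    ∃ j ∈ Finset.Icc 1 N, p - h < a + ((j : ℝ) - 1 / 2) * h ∧ a + ((j : ℝ) - 1 / 2) * h ≤ p := by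
  -- Take the largest midpoint not above `p`; the first one qualifies because it is at most `h / 2`.
  obtain ⟨j, hj, hmax⟩ := Finset.exists_max_image
    ((Finset.Icc 1 N).filter fun j : ℕ => a + ((j : ℝ) - 1 / 2) * h ≤ p) id
    ⟨1, by
      rw [Finset.mem_filter, Finset.mem_Icc]
      refine ⟨⟨le_rfl, hN⟩, ?_⟩
      push_cast
      linarith⟩
  rw [Finset.mem_filter, Finset.mem_Icc] at hj
  refine ⟨j, Finset.mem_Icc.2 hj.1, ?_, hj.2⟩
  by_contra hc
  push Not at hc
  rcases hj.1.2.lt_or_eq with hlt | rfl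
  · have := hmax (j + 1) (by
      rw [Finset.mem_filter, Finset.mem_Icc]
      refine ⟨⟨by omega, hlt⟩, ?_⟩
      push_cast
      linarith)
    simp at this
  · linarith

/-! ### Revenue curves -/

/-- The properties of the noise distribution function that the regret analysis uses. -/
structure IsNoiseCDF (F : ℝ → ℝ) (L b : ℝ) : Prop where
  mono : Monotone F
  nonneg : ∀ x, 0 ≤ F x
  le_one : ∀ x, F x ≤ 1
  eq_one : ∀ x, b ≤ x → F x = 1
  lip : ∀ x y, |F x - F y| ≤ L * |x - y|

namespace IsNoiseCDF

variable {F : ℝ → ℝ} {L b B v p : ℝ}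

theorem rev_nonneg (hF : IsNoiseCDF F L b) (hp : 0 ≤ p) : 0 ≤ rev F v p :=
  mul_nonneg hp (by linarith [hF.le_one (p - v)])

theorem rev_le_self (hF : IsNoiseCDF F L b) (hp : 0 ≤ p) : rev F v p ≤ p :=
  mul_le_of_le_one_right hp (by linarith [hF.nonneg (p - v)])

theorem neg_le_rev (hF : IsNoiseCDF F L b) {W : ℝ} (hW : 0 ≤ W) (hp : -W ≤ p) :
    -W ≤ rev F v p := by
  rcases le_total 0 p with h | h
  · linarith [hF.rev_nonneg (v := v) h]
  · have := hF.le_one (p - v)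
    have := hF.nonneg (p - v)
    unfold rev
    nlinarith

theorem rev_eq_zero (hF : IsNoiseCDF F L b) (hv : v ≤ B - b) (hp : B ≤ p) : rev F v p = 0 := by
  rw [rev, hF.eq_one _ (by linarith)]
  ring

theorem rev_le (hF : IsNoiseCDF F L b) (hB : 0 ≤ B) (hv : v ≤ B - b) (hp : 0 ≤ p) :
    rev F v p ≤ B := by
  rcases le_total B p with h | h
  · rw [hF.rev_eq_zero hv h]
    exact hB
  · exact (hF.rev_le_self hp).trans h

/-- Lowering a price cannot lower demand, so rounding down to the grid loses at most the price
difference; no smoothness of `F` is needed. -/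
theorem rev_le_add (hF : IsNoiseCDF F L b) {q h : ℝ} (hq : 0 ≤ q) (hqp : q ≤ p)
    (hpq : p ≤ q + h) : rev F v p ≤ rev F v q + h := by
  have h1 := hF.mono (show q - v ≤ p - v by linarith)
  have h2 := hF.nonneg (p - v)
  have h3 := hF.le_one (p - v)
  unfold rev
  nlinarith

/-- With `w` the predicted valuation and `m` a midpoint, this removes the context from the demand at
the price `m + w`. -/
theorem abs_sub_le (hF : IsNoiseCDF F L b) (hL : 0 ≤ L) {m w e : ℝ} (hw : |w - v| ≤ e) :
    |F (m + w - v) - F m| ≤ L * e :=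
  (hF.lip _ _).trans (mul_le_mul_of_nonneg_left (by rwa [add_sub_assoc, add_sub_cancel_left]) hL)

end IsNoiseCDF

theorem ind_nonneg (y : Bool) : 0 ≤ ind y := by cases y <;> simp [ind]

theorem ind_le_one (y : Bool) : ind y ≤ 1 := by cases y <;> simp [ind]

/-! ### Deterministic regret analysis of one episode -/

namespace AlgInput

variable {X : Type*} {A : AlgInput X} {tr : Trajectory X} {F : ℝ → ℝ} {L b : ℝ} {vstar : X → ℝ}

theorem episode_eq {k t : ℕ} (hk : 1 ≤ k) (h1 : 2 ^ (k - 1) < t) (h2 : t ≤ 2 ^ k) :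
    episode t = k := by
  refine le_antisymm (Nat.clog_le_of_le_pow h2) ?_
  have := (Nat.lt_clog_iff_pow_lt (b := 2) (by norm_num)).2 h1
  unfold episode
  omega

theorem two_pow_pred_le_expEnd (k : ℕ) : 2 ^ (k - 1) ≤ A.expEnd k := Nat.le_add_right _ _

theorem expEnd_le {k : ℕ} (hk : 1 ≤ k) : A.expEnd k ≤ 2 ^ k := by
  obtain ⟨r, rfl⟩ : ∃ r, k = r + 1 := ⟨k - 1, by omega⟩
  have : A.expLen (r + 1) ≤ 2 ^ r := min_le_left _ _
  simp only [expEnd, Nat.add_sub_cancel, pow_succ]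
  omega

/-- The UCB rounds of episode `k`. -/
noncomputable def ucbRounds (A : AlgInput X) (k : ℕ) : Finset ℕ := Finset.Ioc (A.expEnd k) (2 ^ k)

theorem card_ucbRounds {k : ℕ} (hk : 1 ≤ k) : (A.ucbRounds k).card = A.ucbLen k := by
  obtain ⟨r, rfl⟩ : ∃ r, k = r + 1 := ⟨k - 1, by omega⟩
  simp only [ucbRounds, Nat.card_Ioc, expEnd, ucbLen, ell, Nat.add_sub_cancel, pow_succ]
  omega

theorem episode_eq_of_mem_ucbRounds {k t : ℕ} (hk : 1 ≤ k) (ht : t ∈ A.ucbRounds k) :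
    episode t = k := by
  rw [ucbRounds, Finset.mem_Ioc] at ht
  exact episode_eq hk ((two_pow_pred_le_expEnd k).trans_lt ht.1) ht.2

theorem inUCB_of_mem_ucbRounds {k t : ℕ} (hk : 1 ≤ k) (hks : A.kStar ≤ k)
    (ht : t ∈ A.ucbRounds k) : A.InUCB t := by
  have he := episode_eq_of_mem_ucbRounds hk ht
  rw [ucbRounds, Finset.mem_Ioc] at ht
  refine ⟨lt_of_le_of_lt ?_ ((two_pow_pred_le_expEnd k).trans_lt ht.1), by rw [he]; exact ht.1⟩
  exact Nat.pow_le_pow_right (by norm_num) (by omega)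

theorem InUCB.mem_ucbRounds {t : ℕ} (h : A.InUCB t) :
    1 ≤ episode t ∧ A.kStar ≤ episode t ∧ t ∈ A.ucbRounds (episode t) := by
  have h1 : 1 < t := lt_of_le_of_lt Nat.one_le_two_pow h.1
  have h2 : t ≤ 2 ^ episode t := Nat.le_pow_clog (by norm_num) t
  have h3 : A.kStar - 1 < episode t := (Nat.lt_clog_iff_pow_lt (by norm_num)).2 h.1
  exact ⟨Nat.clog_pos (by norm_num) h1, by omega, Finset.mem_Ioc.2 ⟨h.2, h2⟩⟩

/-- The logarithmic factor of the squared confidence radii of episode `k`. -/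
noncomputable def logFactor (A : AlgInput X) (k : ℕ) : ℝ :=
  2 * Real.log (2 * A.numLayers k * A.gridSize k * A.ucbLen k / A.δ)

/-- Probability of a sale in round `t`, given the context and the price. -/
noncomputable def demand (F : ℝ → ℝ) (vstar : X → ℝ) (tr : Trajectory X) (t : ℕ) : ℝ :=
  1 - F (tr.price t - vstar (tr.ctx t))

/-- In episode `k`, the numbers of sales deviate from the expected numbers of sales by at most
what the confidence radii allow. -/
def Concentrated (A : AlgInput X) (F : ℝ → ℝ) (vstar : X → ℝ) (tr : Trajectory X) (k : ℕ) : Prop :=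
  ∀ t ∈ A.ucbRounds k, ∀ s ∈ Finset.Icc 1 (A.numLayers k), ∀ j ∈ Finset.Icc 1 (A.gridSize k),
    |∑ τ ∈ A.samples tr t s j, (ind (tr.sale τ) - demand F vstar tr τ)| ≤
      Real.sqrt ((A.samples tr t s j).card * A.logFactor k)

theorem mem_ucbRounds_of_mem_samples {k t s j τ : ℕ} (hk : 1 ≤ k) (ht : t ∈ A.ucbRounds k)
    (hτ : τ ∈ A.samples tr t s j) : τ ∈ A.ucbRounds k ∧ τ < t ∧ tr.arm τ = j := by
  rw [samples, episode_eq_of_mem_ucbRounds hk ht, Finset.mem_filter, Finset.mem_Ioo] at hτ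
  rw [ucbRounds, Finset.mem_Ioc] at ht ⊢
  exact ⟨⟨hτ.1.1, by omega⟩, hτ.1.2, hτ.2.2⟩

theorem IsRun.price_eq (hrun : A.IsRun tr) {k t : ℕ} (hk : 1 ≤ k) (hks : A.kStar ≤ k)
    (ht : t ∈ A.ucbRounds k) :
    tr.price t = A.midpoint tr k (tr.arm t) + A.vHat tr k (tr.ctx t) := by
  have h1 : 1 ≤ t := by
    rw [ucbRounds, Finset.mem_Ioc] at ht
    omega
  rw [((hrun t h1).2 (inUCB_of_mem_ucbRounds hk hks ht)).2, candPrice,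
    episode_eq_of_mem_ucbRounds hk ht]

theorem IsRun.layer_arm_mem (hrun : A.IsRun tr) {k t : ℕ} (hk : 1 ≤ k) (hks : A.kStar ≤ k)
    (ht : t ∈ A.ucbRounds k) :
    tr.layer t ∈ Finset.Icc 1 (A.numLayers k) ∧ tr.arm t ∈ Finset.Icc 1 (A.gridSize k) := by
  have h1t : 1 ≤ t := by
    have := Finset.mem_Ioc.1 ht
    omega
  have hep := episode_eq_of_mem_ucbRounds hk ht
  obtain ⟨h1, hS, -, hlt, heq⟩ := ((hrun t h1t).2 (inUCB_of_mem_ucbRounds hk hks ht)).1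
  have harm : tr.arm t ∈ Finset.Icc 1 (A.roundData tr t).N := by
    rcases hS.lt_or_eq with h | h
    · exact (RoundData.mem_active_one.1 (RoundData.active_subset_active_one _ (hlt h).1)).1
    · rcases heq h with h' | h'
      · exact (RoundData.mem_active_one.1 (RoundData.active_subset_active_one _ h'.1)).1
      · exact h'.2
  simp only [roundData, hep] at hS harm
  exact ⟨Finset.mem_Icc.2 ⟨h1, hS⟩, harm⟩

/-- Concentration of the sales and a good predictor make the estimated demands accurate. -/
theorem Concentrated.accurate (hF : IsNoiseCDF F L b) (hL : 0 ≤ L) {e : ℝ} (he : 0 ≤ e)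
    (hrun : A.IsRun tr) {k t : ℕ} (hk : 1 ≤ k) (hks : A.kStar ≤ k)
    (hc : A.Concentrated F vstar tr k) (hv : ∀ x, |A.vHat tr k x - vstar x| ≤ e)
    (ht : t ∈ A.ucbRounds k) :
    (A.roundData tr t).Accurate (fun j => 1 - F (A.midpoint tr k j)) (L * e) := by
  intro s h1 hS j hj
  have hep := episode_eq_of_mem_ucbRounds hk ht
  have hLe : 0 ≤ L * e := mul_nonneg hL he
  simp only [roundData, hep] at hS hj
  have hc := hc t ht s (Finset.mem_Icc.2 ⟨h1, hS⟩) j hj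
  have hθ0 := hF.nonneg (A.midpoint tr k j)
  have hθ1 := hF.le_one (A.midpoint tr k j)
  simp only [RoundData.radius, roundData, hep]
  set n := (A.samples tr t s j).card with hn
  -- Without samples the mean is `0` and the radius `1`, which is accurate because the true mean
  -- lies in `[0, 1]`.
  rcases Nat.eq_zero_or_pos n with h0 | hpos
  · rw [if_pos h0, h0]
    simp only [Nat.cast_zero, div_zero]
    rw [abs_le]
    constructor <;> linarith
  · rw [if_neg hpos.ne']
    have hn0 : (0 : ℝ) < n := by exact_mod_cast hpos
    have havg0 : 0 ≤ (∑ τ ∈ A.samples tr t s j, ind (tr.sale τ)) / n :=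
      div_nonneg (Finset.sum_nonneg fun τ _ => ind_nonneg _) hn0.le
    have havg1 : (∑ τ ∈ A.samples tr t s j, ind (tr.sale τ)) / n ≤ 1 := by
      rw [div_le_one hn0, hn, Finset.card_eq_sum_ones]
      push_cast
      exact Finset.sum_le_sum fun τ _ => ind_le_one _
    -- The cap at `1` is harmless, as both means lie in `[0, 1]`. The uncapped part splits into the
    -- noise of the sales and the bias from the predictor.
    rw [← min_add_add_right]
    refine le_min ?_ ?_
    · have hsplit : (∑ τ ∈ A.samples tr t s j, ind (tr.sale τ)) / n - (1 - F (A.midpoint tr k j))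
          = (∑ τ ∈ A.samples tr t s j, (ind (tr.sale τ) - demand F vstar tr τ)) / n +
            (∑ τ ∈ A.samples tr t s j,
              (demand F vstar tr τ - (1 - F (A.midpoint tr k j)))) / n := by
        rw [← add_div, ← Finset.sum_add_distrib, eq_div_iff hn0.ne', sub_mul,
          div_mul_cancel₀ _ hn0.ne']
        simp only [sub_add_sub_cancel, Finset.sum_sub_distrib, Finset.sum_const, nsmul_eq_mul]
        ring
      rw [hsplit]
      refine (abs_add_le _ _).trans (add_le_add ?_ ?_)
      · rw [abs_div, abs_of_pos hn0, div_le_iff₀ hn0]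
        refine hc.trans (le_of_eq ?_)
        rw [← logFactor]
        nth_rw 3 [← Real.sqrt_sq hn0.le]
        rw [← Real.sqrt_mul' _ (sq_nonneg _)]
        congr 1
        field_simp
      · rw [abs_div, abs_of_pos hn0, div_le_iff₀ hn0]
        refine (Finset.abs_sum_le_sum_abs _ _).trans ?_
        rw [mul_comm, ← nsmul_eq_mul, hn]
        refine Finset.sum_le_card_nsmul _ _ _ fun τ hτ => ?_
        obtain ⟨hτU, -, harm⟩ := mem_ucbRounds_of_mem_samples hk ht hτ
        rw [demand, hrun.price_eq hk hks hτU, harm, sub_sub_sub_cancel_left, abs_sub_comm]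
        exact hF.abs_sub_le hL (hv _)
    · rw [abs_le]
      constructor <;> linarith

/-- Step of the price grid of episode `k`. -/
noncomputable def gridStep (A : AlgInput X) (tr : Trajectory X) (k : ℕ) : ℝ :=
  (A.B + 2 * A.vNorm tr k) / A.gridSize k

/-- Closeness to `vstar` is what bounds the predictor, so that the real `iSup` really dominates it
instead of taking a default value. -/
theorem vNorm_bounds (hB : 0 < A.B) {e : ℝ} (he : e ≤ 1) {k : ℕ}
    (hv0 : ∀ x, 0 ≤ vstar x) (hvB : ∀ x, vstar x ≤ A.B)
    (hv : ∀ x, |A.vHat tr k x - vstar x| ≤ e) :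
    0 ≤ A.vNorm tr k ∧ A.vNorm tr k ≤ A.B + 1 ∧ ∀ x, |A.vHat tr k x| ≤ A.vNorm tr k := by
  have hb : ∀ x, |A.vHat tr k x| ≤ A.B + 1 := fun x => by
    have := abs_le.1 (hv x)
    have := hv0 x
    have := hvB x
    rw [abs_le]
    constructor <;> linarith
  exact ⟨Real.iSup_nonneg fun x => abs_nonneg _, Real.iSup_le hb (by linarith),
    fun x => le_ciSup (f := fun x => |A.vHat tr k x|)
      ⟨A.B + 1, by rintro _ ⟨x, rfl⟩; exact hb x⟩ x⟩

/-- Regret of a single UCB round. -/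
theorem Concentrated.regret_le (hF : IsNoiseCDF F L b) (hL : 0 ≤ L) (hB : 0 < A.B) (hb : 0 ≤ b)
    {e : ℝ} (he : 0 ≤ e) (he1 : e ≤ 1) (hrun : A.IsRun tr) {k t : ℕ} (hk : 1 ≤ k)
    (hks : A.kStar ≤ k)
    (hv0 : ∀ x, 0 ≤ vstar x) (hvB : ∀ x, vstar x ≤ A.B - b)
    (hc : A.Concentrated F vstar tr k) (hv : ∀ x, |A.vHat tr k x - vstar x| ≤ e)
    (ht : t ∈ A.ucbRounds k) {p : ℝ} (hp : 0 ≤ p) :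
    rev F (vstar (tr.ctx t)) p - rev F (vstar (tr.ctx t)) (tr.price t) ≤
      (4 * A.B + 2) / A.B * ((3 * A.B + 2) / A.gridSize k) + 4 * (A.B * (L * e)) * A.numLayers k +
        8 * A.B * (2 : ℝ) ^ (-(tr.layer t : ℤ)) := by
  set x := tr.ctx t with hx
  obtain ⟨hn0, hn1, hnv⟩ := vNorm_bounds (tr := tr) hB he1 hv0 (fun x => by linarith [hvB x]) hv
  have h1t : 1 ≤ t := by
    rw [ucbRounds, Finset.mem_Ioc] at ht
    omega
  have hsel := ((hrun t h1t).2 (inUCB_of_mem_ucbRounds hk hks ht)).1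
  have hprice := hrun.price_eq hk hks ht
  have hep := episode_eq_of_mem_ucbRounds hk ht
  have hacc := hc.accurate hF hL he hrun hk hks hv ht
  have hLe : 0 ≤ L * e := mul_nonneg hL he
  have hθ : ∀ j, (fun j => 1 - F (A.midpoint tr k j)) j ∈ Set.Icc (0 : ℝ) 1 := fun j =>
    ⟨by linarith [hF.le_one (A.midpoint tr k j)], by linarith [hF.nonneg (A.midpoint tr k j)]⟩
  have harm := (hrun.layer_arm_mem hk hks ht).2
  have hN : 0 < A.gridSize k := (Finset.mem_Icc.1 harm).1.trans (Finset.mem_Icc.1 harm).2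
  have hN' : (0 : ℝ) < A.gridSize k := by exact_mod_cast hN
  set h := A.gridStep tr k with hh
  have hh0 : 0 < h := div_pos (by linarith) hN'
  have hhle : h ≤ (3 * A.B + 2) / A.gridSize k :=
    div_le_div_of_nonneg_right (by linarith) hN'.le
  have hNh : A.gridSize k * h = A.B + 2 * A.vNorm tr k := mul_div_cancel₀ _ hN'.ne'
  have hS1 : (1 : ℝ) ≤ tr.layer t := by exact_mod_cast hsel.1
  have hSle : (tr.layer t : ℝ) ≤ A.numLayers k := by
    have := hsel.2.1
    simp only [roundData, hep] at this
    exact_mod_cast this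
  have hBLe : 0 ≤ A.B * (L * e) := mul_nonneg hB.le hLe
  have hz : 0 < (2 : ℝ) ^ (-(tr.layer t : ℤ)) := by positivity
  have hcoef : 1 ≤ (4 * A.B + 2) / A.B := by
    rw [le_div_iff₀ hB]
    linarith
  have hvx := abs_le.1 (hnv x)
  have hmid : ∀ j, A.midpoint tr k j = -A.vNorm tr k + ((j : ℝ) - 1 / 2) * h := fun j => rfl
  -- For `h ≥ B` the grid may contain no candidate, and the posted price may even be negative. The
  -- regret is then at most `4B + 2`, which the grid-step term covers because `h / B ≥ 1`.
  rcases le_or_gt A.B h with hBh | hBh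
  · have h1 : rev F (vstar x) p ≤ A.B := hF.rev_le hB.le (hvB x) hp
    have h2 : -(3 * A.B + 2) ≤ rev F (vstar x) (tr.price t) := by
      refine hF.neg_le_rev (by linarith) ?_
      have : (1 : ℝ) ≤ tr.arm t := by exact_mod_cast (Finset.mem_Icc.1 harm).1
      have : 0 ≤ ((tr.arm t : ℝ) - 1 / 2) * h := mul_nonneg (by linarith) hh0.le
      rw [hprice, hmid]
      linarith
    have h3 : 4 * A.B + 2 ≤ (4 * A.B + 2) / A.B * h := by
      rw [div_mul_eq_mul_div, le_div_iff₀ hB]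
      nlinarith
    have h4 : (4 * A.B + 2) / A.B * h ≤ (4 * A.B + 2) / A.B * ((3 * A.B + 2) / A.gridSize k) :=
      mul_le_mul_of_nonneg_left hhle (by linarith)
    have h5 : 0 ≤ 4 * (A.B * (L * e)) * A.numLayers k := by positivity
    have h6 : 0 ≤ 8 * A.B * (2 : ℝ) ^ (-(tr.layer t : ℤ)) := by positivity
    linarith
  · have hgrid : ∀ q, h ≤ q → q < A.B → ∃ j ∈ (A.roundData tr t).active 1,
        q - h < A.midpoint tr k j + A.vHat tr k x ∧
        A.midpoint tr k j + A.vHat tr k x ≤ q := by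
      intro q hq hqB
      obtain ⟨j, hj, hj1, hj2⟩ := exists_grid_point hN
        (a := -A.vNorm tr k + A.vHat tr k x) (B := A.B) (h := h) (by linarith) (by linarith)
        hq hqB hh0
      have heq : A.midpoint tr k j + A.vHat tr k x =
          -A.vNorm tr k + A.vHat tr k x + ((j : ℝ) - 1 / 2) * h := by
        rw [hmid]
        ring
      refine ⟨j, ?_, by rw [heq]; exact hj1, by rw [heq]; exact hj2⟩
      rw [RoundData.mem_active_one]
      simp only [roundData, candPrice, hep, ← hx]
      rw [heq]
      exact ⟨hj, by linarith, by linarith⟩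
    -- A comparison price outside `[h, B)` earns at most `h`, since no sale occurs from `B` on; then
    -- any candidate will do.
    obtain ⟨j, hj, hjrev⟩ : ∃ j ∈ (A.roundData tr t).active 1,
        rev F (vstar x) p ≤ rev F (vstar x) (A.midpoint tr k j + A.vHat tr k x) + h := by
      by_cases hph : h ≤ p ∧ p < A.B
      · obtain ⟨j, hj, h1, h2⟩ := hgrid p hph.1 hph.2
        exact ⟨j, hj, hF.rev_le_add (by linarith) h2 (by linarith)⟩
      · obtain ⟨j, hj, h1, h2⟩ := hgrid h le_rfl hBh
        refine ⟨j, hj, ?_⟩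
        have h3 := hF.rev_nonneg (v := vstar x) (show 0 ≤ A.midpoint tr k j + A.vHat tr k x by
          linarith)
        rcases lt_or_ge p h with h4 | h4
        · linarith [hF.rev_le_self (v := vstar x) hp]
        · rw [hF.rev_eq_zero (hvB x) (not_lt.1 fun h5 => hph ⟨h4, h5⟩)]
          linarith
    obtain ⟨hjt, hreg⟩ := hacc.sub_le_of_selects hLe hθ hj hsel
    -- Passing between true and surrogate revenue costs `B L e` at each of the two indices; with the
    -- `2 B L e` per layer this gives the factor `4`.
    have hclose : ∀ i ∈ (A.roundData tr t).active 1,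
        |(A.midpoint tr k i + A.vHat tr k x) * (1 - F (A.midpoint tr k i)) -
          rev F (vstar x) (A.midpoint tr k i + A.vHat tr k x)| ≤ A.B * (L * e) := by
      intro i hi
      rw [RoundData.mem_active_one] at hi
      simp only [roundData, candPrice, hep, ← hx] at hi
      rw [rev, ← mul_sub, sub_sub_sub_cancel_left, abs_mul, abs_of_pos hi.2.1]
      exact mul_le_mul hi.2.2.le (hF.abs_sub_le hL (hv x)) (abs_nonneg _) hB.le
    have hc1 := abs_le.1 (hclose j hj)
    have hc2 := abs_le.1 (hclose _ hjt)
    simp only [roundData, candPrice, hep, ← hx] at hreg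
    rw [hprice]
    have h4 : h ≤ (4 * A.B + 2) / A.B * ((3 * A.B + 2) / A.gridSize k) := by
      refine hhle.trans (le_mul_of_one_le_left (hh0.le.trans hhle) hcoef)
    have h5 : A.B * (L * e) * tr.layer t ≤ A.B * (L * e) * A.numLayers k :=
      mul_le_mul_of_nonneg_left hSle hBLe
    have h6 : A.B * (L * e) * 1 ≤ A.B * (L * e) * A.numLayers k :=
      mul_le_mul_of_nonneg_left (hS1.trans hSle) hBLe
    linarith

/-- This replaces the failed-check count at the last layer, where the traversal stops without a
failed check. -/
theorem ucbLen_le_four_pow (k : ℕ) : (A.ucbLen k : ℝ) ≤ 4 ^ A.numLayers k := by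
  rcases Nat.eq_zero_or_pos (A.ucbLen k) with h | h
  · rw [h]
    simp
  · have h0 : (0 : ℝ) < A.ucbLen k := by exact_mod_cast h
    have h1 : (1 / 2 : ℝ) * Real.logb 2 (A.ucbLen k) ≤ A.numLayers k :=
      (Nat.le_ceil _).trans (by exact_mod_cast le_max_right _ _)
    have h2 : Real.logb 2 (A.ucbLen k) ≤ ((2 * A.numLayers k : ℕ) : ℝ) := by
      push_cast
      linarith
    rw [Real.logb_le_iff_le_rpow one_lt_two h0, Real.rpow_natCast, pow_mul] at h2
    norm_num at h2
    exact h2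

/-- Number of UCB rounds of an episode that stop at layer `s < S` with index `j`. -/
theorem IsRun.card_layer_arm_le (hrun : A.IsRun tr) {k : ℕ} (hk : 1 ≤ k) (hks : A.kStar ≤ k)
    {s : ℕ} (hs : s < A.numLayers k) (j : ℕ) :
    (((A.ucbRounds k).filter fun t => tr.layer t = s ∧ tr.arm t = j).card : ℝ) ≤
      |A.logFactor k| * 4 ^ s + 1 := by
  set V := (A.ucbRounds k).filter fun t => tr.layer t = s ∧ tr.arm t = j with hV
  rcases V.eq_empty_or_nonempty with h | h
  · rw [h]
    simp only [Finset.card_empty, Nat.cast_zero]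
    positivity
  -- In the last such round the check failed, which bounds the number of all earlier ones; that
  -- round itself is the `+ 1`.
  · obtain ⟨t, ht, hmax⟩ := Finset.exists_max_image V id h
    have ht' := Finset.mem_filter.1 ht
    have hep := episode_eq_of_mem_ucbRounds hk ht'.1
    have h1t : 1 ≤ t := by
      have := Finset.mem_Ioc.1 ht'.1
      omega
    have hsel := ((hrun t h1t).2 (inUCB_of_mem_ucbRounds hk hks ht'.1)).1
    have hfail := hsel.2.2.2.1 (by simpa only [roundData, hep, ht'.2.1] using hs)
    have hcnt := hfail.cnt_lt
    simp only [roundData, hep, ht'.2.1, ht'.2.2] at hcnt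
    rw [← logFactor] at hcnt
    have hsub : V ⊆ insert t (A.samples tr t s j) := by
      intro τ hτ
      rw [Finset.mem_insert, or_iff_not_imp_left]
      intro hne
      have hle : τ ≤ t := hmax τ hτ
      have hτ' := Finset.mem_filter.1 hτ
      have hτ2 := Finset.mem_Ioc.1 hτ'.1
      rw [samples, hep, Finset.mem_filter, Finset.mem_Ioo]
      exact ⟨⟨hτ2.1, by omega⟩, hτ'.2⟩
    have hcard := (Finset.card_le_card hsub).trans (Finset.card_insert_le _ _)
    have hcard' : (V.card : ℝ) ≤ (A.samples tr t s j).card + 1 := by exact_mod_cast hcard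
    linarith

/-- If `V` are the rounds of layer `s`, then `|V| ≤ len` and `|V| ≤ N (|logFactor| + 1) 4^s`. The
product of the two bounds controls `(|V| 2^{-s})²`, uniformly in the layer. -/
theorem IsRun.sum_two_zpow_layer_le (hrun : A.IsRun tr) {k : ℕ} (hk : 1 ≤ k)
    (hks : A.kStar ≤ k) :
    ∑ t ∈ A.ucbRounds k, (2 : ℝ) ^ (-(tr.layer t : ℤ)) ≤
      A.numLayers k * Real.sqrt (A.ucbLen k * (A.gridSize k * (|A.logFactor k| + 1))) := by
  rcases (A.ucbRounds k).eq_empty_or_nonempty with h | ⟨t₀, ht₀⟩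
  · rw [h, Finset.sum_empty]
    positivity
  have hN := Finset.mem_Icc.1 (hrun.layer_arm_mem hk hks ht₀).2
  have hN1 : (1 : ℝ) ≤ A.gridSize k := by exact_mod_cast hN.1.trans hN.2
  rw [← Finset.sum_fiberwise_of_maps_to (g := tr.layer) (t := Finset.Icc 1 (A.numLayers k))
    fun t ht => (hrun.layer_arm_mem hk hks ht).1]
  have hcardS : ((Finset.Icc 1 (A.numLayers k)).card : ℝ) = A.numLayers k := by simp
  rw [← hcardS, ← nsmul_eq_mul]
  refine Finset.sum_le_card_nsmul _ _ _ fun s hs => ?_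
  set V := (A.ucbRounds k).filter fun t => tr.layer t = s with hV
  have h1 : ∑ t ∈ V, (2 : ℝ) ^ (-(tr.layer t : ℤ)) = V.card * ((2 : ℝ) ^ s)⁻¹ := by
    rw [← nsmul_eq_mul, ← Finset.sum_const]
    refine Finset.sum_congr rfl fun t ht => ?_
    rw [(Finset.mem_filter.1 ht).2, zpow_neg, zpow_natCast]
  rw [h1]
  have h2 : (V.card : ℝ) ≤ A.ucbLen k := by
    rw [← card_ucbRounds hk]
    exact_mod_cast Finset.card_le_card (Finset.filter_subset _ _)
  have h4 : (0 : ℝ) < 4 ^ s := by positivity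
  refine Real.le_sqrt_of_sq_le ?_
  rw [mul_pow, inv_pow, ← pow_mul, mul_comm s 2, pow_mul, show (2 : ℝ) ^ 2 = 4 by norm_num, sq,
    ← div_eq_mul_inv, div_le_iff₀ h4]
  have h3 : (V.card : ℝ) ≤ A.gridSize k * (|A.logFactor k| + 1) * 4 ^ s := by
    have h1s := Finset.mem_Icc.1 hs
    rcases h1s.2.lt_or_eq with hlt | heq
    · rw [Finset.card_eq_sum_card_fiberwise (f := tr.arm) (t := Finset.Icc 1 (A.gridSize k))
        fun t ht => (hrun.layer_arm_mem hk hks (Finset.mem_filter.1 ht).1).2]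
      push_cast
      have hcardN : ((Finset.Icc 1 (A.gridSize k)).card : ℝ) = A.gridSize k := by simp
      rw [mul_assoc, ← hcardN, ← nsmul_eq_mul]
      refine Finset.sum_le_card_nsmul _ _ _ fun j hj => ?_
      rw [Finset.filter_filter]
      refine (hrun.card_layer_arm_le hk hks hlt j).trans ?_
      rw [add_mul, one_mul]
      exact add_le_add le_rfl (one_le_pow₀ (by norm_num))
    · rw [heq]
      refine h2.trans ((ucbLen_le_four_pow k).trans ?_)
      refine le_mul_of_one_le_left (by positivity) ?_
      nlinarith [abs_nonneg (A.logFactor k)]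
  rw [mul_assoc]
  exact mul_le_mul h2 h3 (by positivity) (by positivity)

end AlgInput

/-! ### Measurability of the layer traversal -/

namespace RoundData

variable {Ω : Type*} [MeasurableSpace Ω] {R : Ω → RoundData}

/-- A family of round data with fixed parameters and measurable prices, counts and means. -/
structure IsMeasurable (R : Ω → RoundData) (B δ : ℝ) (N S len : ℕ) : Prop where
  B_eq : ∀ ω, (R ω).B = B
  δ_eq : ∀ ω, (R ω).δ = δ
  N_eq : ∀ ω, (R ω).N = N
  S_eq : ∀ ω, (R ω).S = S
  len_eq : ∀ ω, (R ω).len = len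
  price : ∀ j, Measurable fun ω => (R ω).price j
  cnt : ∀ s j, Measurable fun ω => (R ω).cnt s j
  avg : ∀ s j, Measurable fun ω => (R ω).avg s j

variable {B δ : ℝ} {N S len : ℕ}

namespace IsMeasurable

theorem radius (h : IsMeasurable R B δ N S len) (s j : ℕ) :
    Measurable fun ω => (R ω).radius s j := by
  have hc := h.cnt s j
  have hc' : Measurable fun ω => ((R ω).cnt s j : ℝ) := measurable_from_nat.comp hc
  simp only [RoundData.radius, h.S_eq, h.N_eq, h.len_eq, h.δ_eq]
  refine Measurable.ite (hc (measurableSet_singleton 0)) measurable_const ?_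
  exact ((measurable_const.div hc').sqrt).min measurable_const

theorem ucb (h : IsMeasurable R B δ N S len) (s j : ℕ) :
    Measurable fun ω => (R ω).ucb s j :=
  (h.price j).mul ((h.avg s j).add (h.radius s j))

theorem active_one (h : IsMeasurable R B δ N S len) (j : ℕ) :
    Measurable fun ω => j ∈ (R ω).active 1 := by
  simp only [mem_active_one, h.N_eq, h.B_eq]
  have h1 : Measurable fun ω => 0 < (R ω).price j :=
    measurableSet_setOfPred.1 (measurableSet_lt measurable_const (h.price j))
  have h2 : Measurable fun ω => (R ω).price j < B :=
    measurableSet_setOfPred.1 (measurableSet_lt (h.price j) measurable_const)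
  exact measurable_const.and (h1.and h2)

theorem active (h : IsMeasurable R B δ N S len) {s : ℕ} (hs : 1 ≤ s) :
    ∀ j, Measurable fun ω => j ∈ (R ω).active s := by
  induction s, hs using Nat.le_induction with
  | base => exact h.active_one
  | succ s hs ih =>
    intro j
    simp only [mem_active_succ hs, h.B_eq]
    refine (ih j).and (Measurable.forall fun j' => (ih j').imp ?_)
    exact measurableSet_setOfPred.1 (measurableSet_le ((h.ucb s j').sub_const _) (h.ucb s j))

theorem fails (h : IsMeasurable R B δ N S len) {s : ℕ} (hs : 1 ≤ s) (j : ℕ) :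
    Measurable fun ω => (R ω).Fails s j := by
  simp only [Fails, h.B_eq]
  refine (h.active hs j).and ?_
  exact measurableSet_setOfPred.1
    (measurableSet_lt measurable_const ((h.price j).mul (h.radius s j)))

end IsMeasurable

/-- The layer at which the traversal stops is determined by the round data. -/
theorem Selects.layer_eq_iff {R : RoundData} {s j s' : ℕ} (h : R.Selects s j) :
    s = s' ↔ 1 ≤ s' ∧ s' ≤ R.S ∧ (∀ r, 1 ≤ r → r < s' → ∀ i, ¬ R.Fails r i) ∧
      (s' < R.S → ∃ i, R.Fails s' i) := by
  obtain ⟨h1, hS, hf, hlt, -⟩ := h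
  constructor
  · rintro rfl
    exact ⟨h1, hS, hf, fun h => ⟨j, hlt h⟩⟩
  · rintro ⟨h1', hS', hf', hlt'⟩
    rcases lt_trichotomy s s' with h | h | h
    · exact absurd (hlt (h.trans_le hS')) (hf' s h1 h j)
    · exact h
    · obtain ⟨i, hi⟩ := hlt' (h.trans_le hS)
      exact absurd hi (hf s' h1' h i)

/-- The model postulates only that the arm is nonanticipating. Ties affect the arm but not the
stopping layer, which is the first layer with a failed check, or `S`. -/
theorem IsMeasurable.layer (h : IsMeasurable R B δ N S len) {layer arm : Ω → ℕ}
    (hsel : ∀ ω, (R ω).Selects (layer ω) (arm ω)) : Measurable layer := by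
  refine measurable_to_countable' fun s => ?_
  have : layer ⁻¹' {s} = {ω | 1 ≤ s ∧ s ≤ S ∧
      (∀ r, 1 ≤ r → r < s → ∀ i, ¬ (R ω).Fails r i) ∧ (s < S → ∃ i, (R ω).Fails s i)} := by
    ext ω
    have := (hsel ω).layer_eq_iff (s' := s)
    rw [h.S_eq] at this
    exact this
  rw [this]
  refine measurableSet_setOfPred.2 ?_
  by_cases hs : 1 ≤ s
  · refine measurable_const.and (measurable_const.and (Measurable.and ?_ ?_))
    · refine Measurable.forall fun r => ?_
      by_cases hr : 1 ≤ r
      · exact measurable_const.imp (measurable_const.imp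
          (Measurable.forall fun i => (h.fails hr i).not))
      · simp [hr]
    · exact measurable_const.imp (Measurable.exists fun i => h.fails hs i)
  · simp [hs]

end RoundData

/-! ### Measurability of the trajectory -/

namespace AlgInput

variable {Ω X : Type*} [MeasurableSpace Ω] {A : AlgInput X} {tr : Ω → Trajectory X}

theorem measurable_samples_sum {t s j : ℕ} {f : Ω → ℕ → ℝ}
    (hlayer : ∀ i, A.expEnd (episode t) < i → i < t → Measurable fun ω => (tr ω).layer i)
    (harm : ∀ i, A.expEnd (episode t) < i → i < t → Measurable fun ω => (tr ω).arm i)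
    (hf : ∀ i, A.expEnd (episode t) < i → i < t → Measurable fun ω => f ω i) :
    Measurable fun ω => ∑ τ ∈ A.samples (tr ω) t s j, f ω τ := by
  simp only [samples, Finset.sum_filter]
  refine Finset.measurable_fun_sum _ fun i hi => ?_
  rw [Finset.mem_Ioo] at hi
  refine Measurable.ite ?_ (hf i hi.1 hi.2) measurable_const
  exact (hlayer i hi.1 hi.2 (measurableSet_singleton s)).inter
    (harm i hi.1 hi.2 (measurableSet_singleton j))

theorem measurable_samples_card {t s j : ℕ}
    (hlayer : ∀ i, A.expEnd (episode t) < i → i < t → Measurable fun ω => (tr ω).layer i)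
    (harm : ∀ i, A.expEnd (episode t) < i → i < t → Measurable fun ω => (tr ω).arm i) :
    Measurable fun ω => (A.samples (tr ω) t s j).card := by
  simp only [samples, Finset.card_filter]
  refine Finset.measurable_fun_sum _ fun i hi => ?_
  rw [Finset.mem_Ioo] at hi
  refine Measurable.ite ?_ measurable_const measurable_const
  exact (hlayer i hi.1 hi.2 (measurableSet_singleton s)).inter
    (harm i hi.1 hi.2 (measurableSet_singleton j))

variable [MeasurableSpace X]

/-- The oracle depends measurably on the data. -/
def OracleMeasurableAt (A : AlgInput X) : Prop :=
  ∀ n, Measurable (fun z : (Fin n → X × Bool) × X => A.oracle n z.1 z.2) ∧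
    Measurable fun data : Fin n → X × Bool => ⨆ x, |A.oracle n data x|

theorem measurable_data {k : ℕ}
    (hctx : ∀ i, 2 ^ (k - 1) < i → i ≤ A.expEnd k → Measurable fun ω => (tr ω).ctx i)
    (hsale : ∀ i, 2 ^ (k - 1) < i → i ≤ A.expEnd k → Measurable fun ω => (tr ω).sale i) :
    Measurable fun ω => fun i : Fin (A.expLen k) =>
      ((tr ω).ctx (2 ^ (k - 1) + 1 + i), (tr ω).sale (2 ^ (k - 1) + 1 + i)) := by
  refine measurable_pi_lambda _ fun i => ?_
  have hi : 2 ^ (k - 1) + 1 + (i : ℕ) ≤ A.expEnd k := by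
    have := i.2
    unfold expEnd
    omega
  exact (hctx _ (by omega) hi).prodMk (hsale _ (by omega) hi)

theorem measurable_candPrice (hO : A.OracleMeasurableAt) {t : ℕ}
    (hctx : ∀ i, i ≤ t → Measurable fun ω => (tr ω).ctx i)
    (hsale : ∀ i, 1 ≤ i → i < t → Measurable fun ω => (tr ω).sale i)
    (ht : A.expEnd (episode t) < t) {j : Ω → ℕ} (hj : Measurable j) :
    Measurable fun ω => A.candPrice (tr ω) t (j ω) := by
  have hdata := measurable_data (A := A) (tr := tr) (k := episode t)
    (fun i _ h => hctx i (h.trans ht.le))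
    (fun i h h' => hsale i ((Nat.zero_le _).trans_lt h) (h'.trans_lt ht))
  have hv : Measurable fun ω => A.vHat (tr ω) (episode t) ((tr ω).ctx t) :=
    (hO _).1.comp (hdata.prodMk (hctx t le_rfl))
  have hn : Measurable fun ω => A.vNorm (tr ω) (episode t) := (hO _).2.comp hdata
  have hj' : Measurable fun ω => (j ω : ℝ) := measurable_from_nat.comp hj
  unfold candPrice midpoint
  fun_prop

theorem isMeasurable_roundData (hO : A.OracleMeasurableAt) {t : ℕ}
    (hctx : ∀ i, i ≤ t → Measurable fun ω => (tr ω).ctx i)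
    (hsale : ∀ i, 1 ≤ i → i < t → Measurable fun ω => (tr ω).sale i)
    (hlayer : ∀ i, A.expEnd (episode t) < i → i < t → Measurable fun ω => (tr ω).layer i)
    (harm : ∀ i, A.expEnd (episode t) < i → i < t → Measurable fun ω => (tr ω).arm i)
    (ht : A.expEnd (episode t) < t) :
    RoundData.IsMeasurable (fun ω => A.roundData (tr ω) t) A.B A.δ (A.gridSize (episode t))
      (A.numLayers (episode t)) (A.ucbLen (episode t)) where
  B_eq _ := rfl
  δ_eq _ := rfl
  N_eq _ := rfl
  S_eq _ := rfl
  len_eq _ := rfl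
  price j := measurable_candPrice hO hctx hsale ht measurable_const
  cnt s j := measurable_samples_card hlayer harm
  avg s j := by
    have hc : Measurable fun ω => ((A.samples (tr ω) t s j).card : ℝ) :=
      measurable_from_nat.comp (measurable_samples_card hlayer harm)
    refine (measurable_samples_sum hlayer harm fun i h1 h2 => ?_).div hc
    exact (measurable_from_top (f := ind)).comp (hsale i (by omega) h2)

end AlgInput

/-! ### The history -/

section History

variable {Ω X : Type*} [MeasurableSpace X]

/-- Context, noise and auxiliary draw of a round. -/
def draw (tr : Ω → Trajectory X) (ε : ℕ → Ω → ℝ) (t : ℕ) (ω : Ω) : X × ℝ × ℝ :=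
  ((tr ω).ctx t, ε t ω, (tr ω).unif t)

/-- Everything that is random before the noise of round `t` is drawn. -/
@[reducible] def history (tr : Ω → Trajectory X) (ε : ℕ → Ω → ℝ) (t : ℕ) : MeasurableSpace Ω :=
  (⨆ i ∈ Set.Iio t, MeasurableSpace.comap (draw tr ε i) inferInstance) ⊔
    MeasurableSpace.comap (fun ω => ((tr ω).ctx t, (tr ω).unif t)) inferInstance

variable {tr : Ω → Trajectory X} {ε : ℕ → Ω → ℝ}

theorem measurable_draw_history {i t : ℕ} (h : i < t) :
    Measurable[history tr ε t] (draw tr ε i) :=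
  measurable_iff_comap_le.2 (le_sup_of_le_left (le_iSup₂_of_le i h le_rfl))

theorem measurable_ctx_unif_history {i t : ℕ} (h : i ≤ t) :
    Measurable[history tr ε t] fun ω => ((tr ω).ctx i, (tr ω).unif i) := by
  rcases h.lt_or_eq with h | rfl
  · have := measurable_draw_history (tr := tr) (ε := ε) h
    exact (measurable_fst.prodMk (measurable_snd.comp measurable_snd)).comp this
  · exact measurable_iff_comap_le.2 le_sup_right

theorem measurable_noise_history {i t : ℕ} (h : i < t) :
    Measurable[history tr ε t] (ε i) :=
  (measurable_fst.comp measurable_snd).comp (measurable_draw_history (tr := tr) (ε := ε) h)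

theorem history_mono : Monotone (history tr ε) := by
  intro i t h
  refine sup_le (iSup₂_le fun r hr => ?_) ?_
  · exact (measurable_draw_history (lt_of_lt_of_le hr h)).comap_le
  · exact (measurable_ctx_unif_history h).comap_le

theorem measurable_sale {m : MeasurableSpace Ω} {vstar : X → ℝ} (hv : Measurable vstar)
    (hM : ∀ t ω, (tr ω).sale t = true ↔ (tr ω).price t ≤ vstar ((tr ω).ctx t) + ε t ω) {t : ℕ}
    (hp : Measurable[m] fun ω => (tr ω).price t) (hc : Measurable[m] fun ω => (tr ω).ctx t)
    (he : Measurable[m] (ε t)) : Measurable[m] fun ω => (tr ω).sale t := by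
  refine measurable_to_bool ?_
  have : (fun ω => (tr ω).sale t) ⁻¹' {true} =
      {ω | (tr ω).price t ≤ vstar ((tr ω).ctx t) + ε t ω} := by
    ext ω
    exact hM t ω
  rw [this]
  exact measurableSet_le hp ((hv.comp hc).add he)

variable [mΩ : MeasurableSpace Ω] {P : Measure Ω} {B : ℝ} {μX : Measure X} {ν : Measure ℝ}
  {vstar : X → ℝ}

theorem IsPricingModel.measurable_draw (hM : IsPricingModel P B μX ν vstar ε tr) (t : ℕ) :
    Measurable (draw tr ε t) :=
  (hM.meas_ctx t).prodMk ((hM.meas_noise t).prodMk (hM.meas_unif t))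

theorem IsPricingModel.history_le (hM : IsPricingModel P B μX ν vstar ε tr) (t : ℕ) :
    history tr ε t ≤ mΩ :=
  sup_le (iSup₂_le fun r _ => (hM.measurable_draw r).comap_le)
    ((hM.meas_ctx t).prodMk (hM.meas_unif t)).comap_le

/-- Prices, arms and layers are functions of the history. -/
theorem IsPricingModel.measurable_history (hM : IsPricingModel P B μX ν vstar ε tr)
    (hv : Measurable vstar) {A : AlgInput X} (hO : A.OracleMeasurableAt)
    (hrun : ∀ ω, A.IsRun (tr ω)) (t : ℕ) (ht : 1 ≤ t) :
    Measurable[history tr ε t] (fun ω => (tr ω).price t) ∧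
    Measurable[history tr ε t] (fun ω => (tr ω).arm t) ∧
    (A.InUCB t → Measurable[history tr ε t] fun ω => (tr ω).layer t) := by
  induction t using Nat.strong_induction_on with
  | _ t ih =>
    have hctx : ∀ i, i ≤ t → Measurable[history tr ε t] fun ω => (tr ω).ctx i := fun i hi =>
      measurable_fst.comp (measurable_ctx_unif_history hi)
    have hprice : ∀ i, 1 ≤ i → i < t → Measurable[history tr ε t] fun ω => (tr ω).price i :=
      fun i h1 hi => (ih i hi h1).1.mono (history_mono hi.le) le_rfl
    have hsale : ∀ i, 1 ≤ i → i < t → Measurable[history tr ε t] fun ω => (tr ω).sale i :=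
      fun i h1 hi => measurable_sale hv hM.sale_iff (hprice i h1 hi) (hctx i hi.le)
        (measurable_noise_history hi)
    have harm' : ∀ i, 1 ≤ i → i < t → Measurable[history tr ε t] fun ω => (tr ω).arm i :=
      fun i h1 hi => (ih i hi h1).2.1.mono (history_mono hi.le) le_rfl
    -- Earlier prices and sales are functions of the history by induction, so the seller's
    -- information is part of it.
    have hinfo : sellerInfo tr t ≤ history tr ε t := by
      refine sup_le (iSup₂_le fun i hi => ?_) (iSup₂_le fun i hi => ?_)
      · exact (measurable_ctx_unif_history hi.2).comap_le
      · exact ((hprice i hi.1 hi.2).prodMk (hsale i hi.1 hi.2)).comap_le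
    have harm : Measurable[history tr ε t] fun ω => (tr ω).arm t :=
      (hM.nonanticipating t ht).mono hinfo le_rfl
    by_cases hU : A.InUCB t
    · obtain ⟨hk, hks, hmem⟩ := hU.mem_ucbRounds
      have hlayer : ∀ i, A.expEnd (AlgInput.episode t) < i → i < t →
          Measurable[history tr ε t] fun ω => (tr ω).layer i := by
        intro i h1 h2
        have hi : i ∈ A.ucbRounds (AlgInput.episode t) :=
          Finset.mem_Ioc.2 ⟨h1, h2.le.trans (Finset.mem_Ioc.1 hmem).2⟩
        exact ((ih i h2 (by omega)).2.2 (AlgInput.inUCB_of_mem_ucbRounds hk hks hi)).mono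
          (history_mono h2.le) le_rfl
      refine ⟨?_, harm, fun _ => ?_⟩
      · have heq : (fun ω => (tr ω).price t) = fun ω => A.candPrice (tr ω) t ((tr ω).arm t) :=
          funext fun ω => ((hrun ω t ht).2 hU).2
        rw [heq]
        exact @AlgInput.measurable_candPrice Ω X (history tr ε t) A tr _ hO t hctx hsale hU.2 _ harm
      · exact @RoundData.IsMeasurable.layer Ω (history tr ε t) _ _ _ _ _ _
          (@AlgInput.isMeasurable_roundData Ω X
          (history tr ε t) A tr _ hO t hctx hsale hlayer
            (fun i h1 h2 => harm' i (by omega) h2) hU.2)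
          _ _ fun ω => ((hrun ω t ht).2 hU).1
    · have heq : (fun ω => (tr ω).price t) = fun ω => (tr ω).unif t :=
        funext fun ω => (hrun ω t ht).1 hU
      refine ⟨?_, harm, fun h => absurd h hU⟩
      rw [heq]
      exact measurable_snd.comp (measurable_ctx_unif_history le_rfl)

end History

/-! ### Independence of the noise from the history -/

section Independence

/-- Checked on the π-system of intersections, where both sides factor. In the application `m₁` is
the past, `m₂` the current context and auxiliary draw, and `m₃` the current noise. -/
theorem _root_.ProbabilityTheory.Indep.sup_left_of_sup_right {Ω : Type*}
    {m₁ m₂ m₃ mΩ : MeasurableSpace Ω} {P : Measure Ω} [IsProbabilityMeasure P]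
    (h₁ : m₁ ≤ mΩ) (h₂ : m₂ ≤ mΩ) (h₃ : m₃ ≤ mΩ)
    (h : Indep m₁ (m₂ ⊔ m₃) P) (h' : Indep m₂ m₃ P) : Indep (m₁ ⊔ m₂) m₃ P := by
  set p : Set (Set Ω) :=
    {s | ∃ a b, MeasurableSet[m₁] a ∧ MeasurableSet[m₂] b ∧ a ∩ b = s} with hp
  have hgen : m₁ ⊔ m₂ = MeasurableSpace.generateFrom p := by
    refine le_antisymm (sup_le (fun a ha => ?_) fun b hb => ?_)
      (MeasurableSpace.generateFrom_le ?_)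
    · exact MeasurableSpace.measurableSet_generateFrom
        ⟨a, Set.univ, ha, MeasurableSet.univ, Set.inter_univ a⟩
    · exact MeasurableSpace.measurableSet_generateFrom
        ⟨Set.univ, b, MeasurableSet.univ, hb, Set.univ_inter b⟩
    · rintro _ ⟨a, b, ha, hb, rfl⟩
      exact MeasurableSet.inter (le_sup_left (a := m₁) _ ha) (le_sup_right (a := m₁) _ hb)
  refine IndepSets.indep (sup_le h₁ h₂) h₃ ?_ (@MeasurableSpace.isPiSystem_measurableSet Ω m₃)
    hgen (@MeasurableSpace.generateFrom_measurableSet Ω m₃).symm ?_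
  · rintro _ ⟨a, b, ha, hb, rfl⟩ _ ⟨a', b', ha', hb', rfl⟩ -
    exact ⟨a ∩ a', b ∩ b', ha.inter ha', hb.inter hb', Set.inter_inter_inter_comm _ _ _ _⟩
  · rw [IndepSets_iff]
    rintro _ c ⟨a, b, ha, hb, rfl⟩ hc
    rw [Indep_iff] at h h'
    rw [Set.inter_assoc, h a (b ∩ c) ha
      (MeasurableSet.inter (le_sup_left (a := m₂) _ hb) (le_sup_right (a := m₂) _ hc)),
      h' b c hb hc, h a b ha (le_sup_left (a := m₂) _ hb), mul_assoc]

variable {Ω X : Type*} [MeasurableSpace X] [mΩ : MeasurableSpace Ω] {P : Measure Ω}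
  {B : ℝ} {μX : Measure X} {ν : Measure ℝ} {vstar : X → ℝ}
  {ε : ℕ → Ω → ℝ} {tr : Ω → Trajectory X}

theorem isProbabilityMeasure_cond_Ioo (hB : 0 < B) :
    IsProbabilityMeasure (ProbabilityTheory.cond volume (Set.Ioo 0 B)) := by
  refine cond_isProbabilityMeasure_of_finite ?_ ?_
  · simpa using hB
  · simp

variable [IsProbabilityMeasure μX] [IsProbabilityMeasure ν]

theorem IsPricingModel.map_noise (hM : IsPricingModel P B μX ν vstar ε tr) (hB : 0 < B) (t : ℕ) :
    P.map (ε t) = ν := by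
  have := isProbabilityMeasure_cond_Ioo hB
  have h : ε t = (fun z : X × ℝ × ℝ => z.2.1) ∘ draw tr ε t := rfl
  rw [h, ← Measure.map_map (by fun_prop) (hM.measurable_draw t)]
  unfold draw
  rw [hM.law t, ← Function.comp_def (f := Prod.fst) (g := Prod.snd),
    ← Measure.map_map measurable_fst measurable_snd,
    Measure.map_snd_prod, measure_univ, one_smul, Measure.map_fst_prod, measure_univ, one_smul]

variable [IsProbabilityMeasure P]

theorem IsPricingModel.indepFun_ctx_unif_noise (hM : IsPricingModel P B μX ν vstar ε tr)
    (hB : 0 < B) (t : ℕ) : IndepFun (fun ω => ((tr ω).ctx t, (tr ω).unif t)) (ε t) P := by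
  have := isProbabilityMeasure_cond_Ioo hB
  set U := ProbabilityTheory.cond volume (Set.Ioo 0 B)
  have h1 : Measurable fun ω => ((tr ω).ctx t, (tr ω).unif t) :=
    (hM.meas_ctx t).prodMk (hM.meas_unif t)
  have hlaw : P.map (fun ω => (((tr ω).ctx t, (tr ω).unif t), ε t ω)) = (μX.prod U).prod ν := by
    have h2 : (fun ω => (((tr ω).ctx t, (tr ω).unif t), ε t ω)) =
        (MeasurableEquiv.prodAssoc.symm ∘ Prod.map id Prod.swap) ∘ draw tr ε t := rfl
    rw [h2, ← Measure.map_map (by fun_prop) (hM.measurable_draw t)]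
    unfold draw
    rw [hM.law t, ← Measure.map_map (by fun_prop) (by fun_prop),
      ← Measure.map_prod_map _ _ measurable_id measurable_swap, Measure.map_id,
      Measure.prod_swap, ← Measure.prodAssoc_prod, Measure.map_map (by fun_prop) (by fun_prop),
      MeasurableEquiv.symm_comp_self, Measure.map_id]
  rw [indepFun_iff_map_prod_eq_prod_map_map h1.aemeasurable (hM.meas_noise t).aemeasurable, hlaw,
    hM.map_noise hB t]
  congr 1
  have h3 : (fun ω => ((tr ω).ctx t, (tr ω).unif t)) =
    Prod.fst ∘ fun ω => (((tr ω).ctx t, (tr ω).unif t), ε t ω) := rfl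
  rw [h3, ← Measure.map_map measurable_fst (h1.prodMk (hM.meas_noise t)), hlaw,
    Measure.map_fst_prod, measure_univ, one_smul]

theorem IsPricingModel.indep_history_noise (hM : IsPricingModel P B μX ν vstar ε tr)
    (hB : 0 < B) (t : ℕ) :
    Indep (history tr ε t) (MeasurableSpace.comap (ε t) inferInstance) P := by
  have hle : ∀ i, MeasurableSpace.comap (draw tr ε i) inferInstance ≤ mΩ := fun i =>
    (hM.measurable_draw i).comap_le
  have hcu : Measurable[MeasurableSpace.comap (draw tr ε t) inferInstance]
      fun ω => ((tr ω).ctx t, (tr ω).unif t) :=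
    (measurable_fst.prodMk (measurable_snd.comp measurable_snd)).comp
      (comap_measurable (draw tr ε t))
  have hn : Measurable[MeasurableSpace.comap (draw tr ε t) inferInstance] (ε t) :=
    (measurable_fst.comp measurable_snd).comp (comap_measurable (draw tr ε t))
  refine Indep.sup_left_of_sup_right (iSup₂_le fun i _ => hle i)
    ((hM.meas_ctx t).prodMk (hM.meas_unif t)).comap_le (hM.meas_noise t).comap_le ?_
    ((IndepFun_iff_Indep _ _ _).1 (hM.indepFun_ctx_unif_noise hB t))
  have h := indep_iSup_of_disjoint hle ((iIndepFun_iff_iIndep _ _ P).1 hM.indep)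
    (S := Set.Iio t) (T := {t}) (by simp)
  refine indep_of_indep_of_le_right h (sup_le ?_ ?_)
  · exact hcu.comap_le.trans (le_iSup₂_of_le t rfl le_rfl)
  · exact hn.comap_le.trans (le_iSup₂_of_le t rfl le_rfl)

/-- Tonelli as a substitute for conditioning: freeze the history and integrate over the noise alone.
-/
theorem _root_.ProbabilityTheory.IndepFun.lintegral_comp_prod {Ω' E : Type*} [MeasurableSpace Ω']
    [MeasurableSpace E] {π : Ω → Ω'} {e : Ω → E} (hπ : Measurable π) (he : Measurable e)
    (h : IndepFun π e P) {f : Ω' × E → ENNReal} (hf : Measurable f) :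
    ∫⁻ ω, f (π ω, e ω) ∂P = ∫⁻ ω, ∫⁻ x, f (π ω, x) ∂(P.map e) ∂P := by
  have : IsProbabilityMeasure (P.map e) := Measure.isProbabilityMeasure_map he.aemeasurable
  rw [← lintegral_map hf (hπ.prodMk he),
    (indepFun_iff_map_prod_eq_prod_map_map hπ.aemeasurable he.aemeasurable).1 h,
    lintegral_prod _ hf.aemeasurable,
    lintegral_map (f := fun y => ∫⁻ x, f (y, x) ∂(P.map e)) hf.lintegral_prod_right' hπ]

end Independence

/-! ### Hoeffding's lemma for a single sale -/

/-- A sale at equality counts, so the probability is one minus the left limit of the distribution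
function; continuity removes the difference. -/
theorem integral_sale {ν : Measure ℝ} [IsProbabilityMeasure ν] {L : ℝ} (hL : 0 ≤ L)
    (hlip : ∀ a b : ℝ, |cdf ν a - cdf ν b| ≤ L * |a - b|) (a : ℝ) :
    ∫ x, (if a ≤ x then (1 : ℝ) else 0) ∂ν = 1 - cdf ν a := by
  have hcont : Continuous (cdf ν) :=
    (LipschitzWith.of_dist_le_mul (K := ⟨L, hL⟩) fun x y => hlip x y).continuous
  have h1 : (fun x => if a ≤ x then (1 : ℝ) else 0) = (Set.Ici a).indicator 1 := by
    ext x
    simp [Set.indicator_apply]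
  rw [h1, integral_indicator_one measurableSet_Ici, measureReal_def]
  nth_rw 1 [← measure_cdf ν]
  rw [StieltjesFunction.measure_Ici _ (tendsto_cdf_atTop ν),
    (hcont.continuousAt.continuousWithinAt).leftLim_eq,
    ENNReal.toReal_ofReal (by linarith [cdf_le_one ν a])]

theorem lintegral_exp_sale_le {ν : Measure ℝ} [IsProbabilityMeasure ν] {L : ℝ} (hL : 0 ≤ L)
    (hlip : ∀ a b : ℝ, |cdf ν a - cdf ν b| ≤ L * |a - b|) (a l : ℝ) :
    ∫⁻ x, ENNReal.ofReal (Real.exp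
      (l * ((if a ≤ x then (1 : ℝ) else 0) - (1 - cdf ν a)) - l ^ 2 / 8)) ∂ν ≤ 1 := by
  have hm : Measurable fun x : ℝ => if a ≤ x then (1 : ℝ) else 0 :=
    Measurable.ite measurableSet_Ici measurable_const measurable_const
  have h := hasSubgaussianMGF_of_mem_Icc (μ := ν) (a := 0) (b := 1) hm.aemeasurable
    (Filter.Eventually.of_forall fun x => by
      show (if a ≤ x then (1 : ℝ) else 0) ∈ Set.Icc 0 1
      split_ifs <;> simp)
  rw [integral_sale hL hlip] at h
  have hint := h.integrable_exp_mul l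
  have hle := h.mgf_le l
  rw [mgf] at hle
  simp only [Real.exp_sub (l * _), div_eq_mul_inv _ (Real.exp (l ^ 2 / 8))]
  rw [← ofReal_integral_eq_lintegral_ofReal (hint.mul_const _)
    (Filter.Eventually.of_forall fun x => by positivity), integral_mul_const,
    ENNReal.ofReal_le_one, ← div_eq_mul_inv, div_le_one (Real.exp_pos _)]
  refine hle.trans (Real.exp_le_exp.2 (le_of_eq ?_))
  norm_num
  ring

/-- One step of the exponential supermartingale of the sales. -/
theorem lintegral_mul_exp_sale_le {Ω Ω' : Type*} [MeasurableSpace Ω] [MeasurableSpace Ω']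
    {P : Measure Ω} [IsProbabilityMeasure P] {ν : Measure ℝ} [IsProbabilityMeasure ν] {L : ℝ}
    (hL : 0 ≤ L) (hlip : ∀ a b : ℝ, |cdf ν a - cdf ν b| ≤ L * |a - b|) {π : Ω → Ω'}
    (hπ : Measurable π) {e : Ω → ℝ} (he : Measurable e) (heν : P.map e = ν)
    (hind : IndepFun π e P) {M : Ω' → ENNReal} (hM : Measurable M) {I : Set Ω'}
    (hI : MeasurableSet I) {a : Ω' → ℝ} (ha : Measurable a) (l : ℝ) [DecidablePred (· ∈ I)] :
    ∫⁻ ω, M (π ω) * ENNReal.ofReal (Real.exp (if π ω ∈ I then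
      l * ((if a (π ω) ≤ e ω then (1 : ℝ) else 0) - (1 - cdf ν (a (π ω)))) - l ^ 2 / 8 else 0)) ∂P ≤
    ∫⁻ ω, M (π ω) ∂P := by
  have hcdf : Measurable (cdf ν) := (monotone_cdf ν).measurable
  have hexp : Measurable fun z : Ω' × ℝ => ENNReal.ofReal (Real.exp (if z.1 ∈ I then
      l * ((if a z.1 ≤ z.2 then (1 : ℝ) else 0) - (1 - cdf ν (a z.1))) - l ^ 2 / 8 else 0)) := by
    have h3 : Measurable fun z : Ω' × ℝ => a z.1 := ha.comp measurable_fst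
    refine ENNReal.measurable_ofReal.comp (Real.measurable_exp.comp ?_)
    refine Measurable.ite (measurable_fst hI) ?_ measurable_const
    refine ((Measurable.sub ?_ ((hcdf.comp h3).const_sub 1)).const_mul l).sub_const _
    exact Measurable.ite (measurableSet_le h3 measurable_snd) measurable_const measurable_const
  refine (hind.lintegral_comp_prod hπ he ((hM.comp measurable_fst).mul hexp)).trans_le ?_
  rw [heν]
  refine lintegral_mono fun ω => ?_
  simp only [Pi.mul_apply, Function.comp_apply]
  refine (lintegral_const_mul _ (hexp.comp measurable_prodMk_left)).trans_le ?_
  refine mul_le_of_le_one_right' ?_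
  simp only [Function.comp_apply]
  by_cases hω : π ω ∈ I
  · simp only [hω, if_true]
    exact lintegral_exp_sale_le hL hlip (a (π ω)) l
  · simp [hω]

open AlgInput

/-! ### Concentration of the sales -/

section Concentration

variable {Ω X : Type*} {A : AlgInput X} {L : ℝ} {vstar : X → ℝ}

/-- Exponent of the supermartingale of the sales of layer `s` and index `j` in episode `k`,
after the rounds before `t`. -/
noncomputable def saleExponent (A : AlgInput X) (F : ℝ → ℝ) (vstar : X → ℝ) (k s j : ℕ) (l : ℝ)
    (tr : Trajectory X) (t : ℕ) : ℝ :=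
  ∑ τ ∈ Finset.Ioo (A.expEnd k) t, if tr.layer τ = s ∧ tr.arm τ = j then
    l * (ind (tr.sale τ) - demand F vstar tr τ) - l ^ 2 / 8 else 0

theorem saleExponent_succ (F : ℝ → ℝ) {k s j : ℕ} {l : ℝ} {tr : Trajectory X} {t : ℕ}
    (ht : A.expEnd k < t) :
    saleExponent A F vstar k s j l tr (t + 1) = saleExponent A F vstar k s j l tr t +
      if tr.layer t = s ∧ tr.arm t = j then
        l * (ind (tr.sale t) - demand F vstar tr t) - l ^ 2 / 8 else 0 := by
  have h : Finset.Ioo (A.expEnd k) (t + 1) = insert t (Finset.Ioo (A.expEnd k) t) := by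
    ext i
    simp only [Finset.mem_Ioo, Finset.mem_insert]
    omega
  rw [saleExponent, h, Finset.sum_insert (by simp), add_comm]
  rfl

theorem saleExponent_eq {F : ℝ → ℝ} {k s j : ℕ} {l : ℝ} {tr : Trajectory X} {t : ℕ}
    (hk : 1 ≤ k) (ht : t ∈ A.ucbRounds k) :
    saleExponent A F vstar k s j l tr t =
      l * ∑ τ ∈ A.samples tr t s j, (ind (tr.sale τ) - demand F vstar tr τ) -
        l ^ 2 / 8 * (A.samples tr t s j).card := by
  rw [saleExponent, ← Finset.sum_filter, samples, episode_eq_of_mem_ucbRounds hk ht,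
    Finset.sum_sub_distrib, Finset.mul_sum, Finset.sum_const, nsmul_eq_mul, mul_comm (l ^ 2 / 8)]

theorem one_le_numLayers (k : ℕ) : 1 ≤ A.numLayers k := le_max_left _ _

variable [MeasurableSpace X] [mΩ : MeasurableSpace Ω] {P : Measure Ω}
  [IsProbabilityMeasure P] {B : ℝ} {μX : Measure X} {ν : Measure ℝ}
  {ε : ℕ → Ω → ℝ} {tr : Ω → Trajectory X} [IsProbabilityMeasure μX] [IsProbabilityMeasure ν]

/-- Whether a round belongs to layer `s` and index `j` is decided before its noise is drawn, so each
step multiplies by a factor of conditional mean at most `1`. The adaptive choice of samples does no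
harm. -/
theorem IsPricingModel.lintegral_exp_saleExponent_le (hM : IsPricingModel P B μX ν vstar ε tr)
    (hB : 0 < B) (hv : Measurable vstar) (hO : A.OracleMeasurableAt)
    (hrun : ∀ ω, A.IsRun (tr ω)) (hL : 0 ≤ L)
    (hlip : ∀ a b : ℝ, |cdf ν a - cdf ν b| ≤ L * |a - b|) {k : ℕ} (hk : 1 ≤ k)
    (hks : A.kStar ≤ k) (s j : ℕ) (l : ℝ) {t : ℕ} (h1 : A.expEnd k + 1 ≤ t) (h2 : t ≤ 2 ^ k) :
    (Measurable[history tr ε t] fun ω =>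
      ENNReal.ofReal (Real.exp (saleExponent A (cdf ν) vstar k s j l (tr ω) t))) ∧
    ∫⁻ ω, ENNReal.ofReal (Real.exp (saleExponent A (cdf ν) vstar k s j l (tr ω) t)) ∂P ≤ 1 := by
  have hU : ∀ i, A.expEnd k < i → i ≤ 2 ^ k → i ∈ A.ucbRounds k := fun i h h' =>
    Finset.mem_Ioc.2 ⟨h, h'⟩
  have hmeas : ∀ i, A.expEnd k < i → i ≤ 2 ^ k →
      Measurable[history tr ε i] (fun ω => (tr ω).price i) ∧
      MeasurableSet[history tr ε i] {ω | (tr ω).layer i = s ∧ (tr ω).arm i = j} := by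
    intro i h h'
    obtain ⟨hp, ha, hl⟩ := hM.measurable_history hv hO hrun i (by omega)
    exact ⟨hp, (hl (inUCB_of_mem_ucbRounds hk hks (hU i h h')) (measurableSet_singleton s)).inter
      (ha (measurableSet_singleton j))⟩
  have hcdf : Measurable (cdf ν) := (monotone_cdf ν).measurable
  have hctx : ∀ i r, i ≤ r → Measurable[history tr ε r] fun ω => (tr ω).ctx i := fun i r hir =>
    measurable_fst.comp (measurable_ctx_unif_history hir)
  have hexp : ∀ t, t ≤ 2 ^ k → Measurable[history tr ε t] fun ω =>
      ENNReal.ofReal (Real.exp (saleExponent A (cdf ν) vstar k s j l (tr ω) t)) := by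
    intro t ht
    refine ENNReal.measurable_ofReal.comp (Real.measurable_exp.comp ?_)
    unfold saleExponent
    refine @Finset.measurable_fun_sum _ _ _ _ _ _ (history tr ε t) _ _ fun i hi => ?_
    rw [Finset.mem_Ioo] at hi
    obtain ⟨hp, hs⟩ := hmeas i hi.1 (by omega)
    have hp' : Measurable[history tr ε t] fun ω => (tr ω).price i :=
      hp.mono (history_mono hi.2.le) le_rfl
    have hc := hctx i t hi.2.le
    have hsale : Measurable[history tr ε t] fun ω => (tr ω).sale i :=
      measurable_sale hv hM.sale_iff hp' hc (measurable_noise_history hi.2)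
    refine Measurable.ite (history_mono hi.2.le _ hs) ?_ measurable_const
    refine Measurable.sub_const (Measurable.const_mul (Measurable.sub ?_ ?_) l) _
    · exact (measurable_from_top (f := ind)).comp hsale
    · exact (hcdf.comp (hp'.sub (hv.comp hc))).const_sub 1
  refine ⟨hexp t h2, ?_⟩
  induction t, h1 using Nat.le_induction with
  | base =>
    have : Finset.Ioo (A.expEnd k) (A.expEnd k + 1) = ∅ := by
      ext i
      simp only [Finset.mem_Ioo, Finset.notMem_empty, iff_false]
      omega
    simp [saleExponent, this]
  | succ t h1 ih =>
    classical
    refine le_trans ?_ (ih (by omega))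
    -- The history is encoded as the identity map into `Ω` with the smaller σ-algebra, so that it
    -- can be frozen like a random variable.
    have hind : @IndepFun Ω Ω ℝ mΩ (history tr ε t) _ id (ε t) P := by
      refine (@IndepFun_iff_Indep Ω Ω ℝ mΩ (history tr ε t) _ id (ε t) P).2 ?_
      rw [MeasurableSpace.comap_id]
      exact hM.indep_history_noise hB t
    obtain ⟨hp, hs⟩ := hmeas t h1 (by omega)
    have key := @lintegral_mul_exp_sale_le Ω Ω mΩ (history tr ε t) P _ ν _ L hL hlip id
      (measurable_id'' (hM.history_le t)) (ε t) (hM.meas_noise t) (hM.map_noise hB t) hind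
      _ (hexp t (by omega)) _ hs _ (hp.sub (hv.comp (hctx t t le_rfl))) l _
    refine le_trans (le_of_eq ?_) key
    refine lintegral_congr fun ω => ?_
    rw [saleExponent_succ _ h1, Real.exp_add, ENNReal.ofReal_mul (Real.exp_pos _).le]
    have hind : ind ((tr ω).sale t) =
        if (tr ω).price t - vstar ((tr ω).ctx t) ≤ ε t ω then 1 else 0 := by
      simp only [ind, hM.sale_iff t ω, sub_le_iff_le_add']
    rw [hind]
    rfl

/-- The confidence radii of an episode fail with probability at most `δ`. -/
theorem IsPricingModel.measure_not_concentrated_le (hM : IsPricingModel P B μX ν vstar ε tr)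
    (hB : 0 < B) (hv : Measurable vstar) (hO : A.OracleMeasurableAt)
    (hrun : ∀ ω, A.IsRun (tr ω)) (hL : 0 ≤ L)
    (hlip : ∀ a b : ℝ, |cdf ν a - cdf ν b| ≤ L * |a - b|) (hδ : 0 < A.δ) (hδ1 : A.δ ≤ 1)
    {k : ℕ} (hk : 1 ≤ k) (hks : A.kStar ≤ k) :
    P {ω | ¬ A.Concentrated (cdf ν) vstar (tr ω) k} ≤ ENNReal.ofReal A.δ := by
  rcases Nat.eq_zero_or_pos (A.ucbLen k) with h0 | hlen
  · rw [← card_ucbRounds hk, Finset.card_eq_zero] at h0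
    simp [Concentrated, h0]
  rcases Nat.eq_zero_or_pos (A.gridSize k) with h0 | hN
  · simp [Concentrated, h0]
  set N := A.gridSize k with hNdef
  set S := A.numLayers k with hSdef
  set n := A.ucbLen k with hndef
  set x : ℝ := 2 * S * N * n / A.δ with hx
  have hS : (1 : ℝ) ≤ S := by exact_mod_cast one_le_numLayers k
  have hN' : (1 : ℝ) ≤ N := by exact_mod_cast hN
  have hn' : (1 : ℝ) ≤ n := by exact_mod_cast hlen
  have hSN : (1 : ℝ) ≤ S * N := one_le_mul_of_one_le_of_one_le hS hN'
  have hprod : (2 : ℝ) * n ≤ 2 * S * N * n := by nlinarith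
  have hxδ : x * A.δ = 2 * S * N * n := div_mul_cancel₀ _ hδ.ne'
  have hx1 : 1 < x := by
    rw [hx, lt_div_iff₀ hδ]
    linarith
  have hx0 : 0 < x := by linarith
  have hlog : A.logFactor k = 2 * Real.log x := rfl
  have hlog0 : 0 < Real.log x := Real.log_pos hx1
  -- This parameter maximises `λ D - λ² c / 8` at the threshold `|D| = √(c · logFactor)`. It depends
  -- on the random sample count `c`, hence the union over all values of `c`, and over the two signs.
  set lam : ℕ × ℝ → ℝ := fun q => q.2 * (4 * Real.sqrt (A.logFactor k / q.1)) with hlam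
  set idx : Finset (ℕ × ℕ × ℕ × ℕ × ℝ) := A.ucbRounds k ×ˢ Finset.Icc 1 S ×ˢ Finset.Icc 1 N ×ˢ
    Finset.Icc 1 n ×ˢ {1, -1} with hidx
  have hcard : idx.card = n * (S * (N * (n * 2))) := by
    rw [hidx]
    simp only [Finset.card_product, card_ucbRounds hk, Nat.card_Icc, Nat.add_sub_cancel]
    rw [Finset.card_pair (by norm_num)]
  have hsub : {ω | ¬ A.Concentrated (cdf ν) vstar (tr ω) k} ⊆ ⋃ q ∈ idx,
      {ω | ENNReal.ofReal (x ^ 4) ≤ ENNReal.ofReal (Real.exp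
        (saleExponent A (cdf ν) vstar k q.2.1 q.2.2.1 (lam q.2.2.2) (tr ω) q.1))} := by
    intro ω hω
    simp only [Concentrated, Set.mem_ofPred_eq, not_forall, not_le] at hω
    obtain ⟨t, ht, s, hs, j, hj, hlt⟩ := hω
    set c := (A.samples (tr ω) t s j).card with hc
    set D := ∑ τ ∈ A.samples (tr ω) t s j, (ind ((tr ω).sale τ) - demand (cdf ν) vstar (tr ω) τ)
      with hD
    have hcn : c ≤ n := by
      rw [hndef, ← card_ucbRounds hk]
      exact Finset.card_le_card fun τ hτ => (mem_ucbRounds_of_mem_samples hk ht hτ).1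
    have hc1 : 1 ≤ c := by
      by_contra h
      have h0 : c = 0 := by omega
      have : A.samples (tr ω) t s j = ∅ := Finset.card_eq_zero.1 h0
      rw [hD, this] at hlt
      simp [h0] at hlt
    have hc0 : (0 : ℝ) < c := by exact_mod_cast hc1
    obtain ⟨σ, hσ, hσD⟩ : ∃ σ ∈ ({1, -1} : Finset ℝ), σ * D = |D| := by
      rcases abs_choice D with h | h
      · exact ⟨1, by simp, by rw [h, one_mul]⟩
      · exact ⟨-1, by simp, by rw [h, neg_one_mul]⟩
    have hσ2 : σ ^ 2 = 1 := by
      simp only [Finset.mem_insert, Finset.mem_singleton] at hσ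
      rcases hσ with rfl | rfl <;> norm_num
    simp only [Set.mem_iUnion]
    refine ⟨(t, s, j, c, σ), ?_, ?_⟩
    · simp only [hidx, Finset.mem_product]
      exact ⟨ht, hs, hj, Finset.mem_Icc.2 ⟨hc1, hcn⟩, hσ⟩
    -- The exponent is at least `8 log x - 4 log x = 4 log x`.
    · refine ENNReal.ofReal_le_ofReal ?_
      rw [saleExponent_eq hk ht, ← hD, ← hc, ← Real.exp_log hx0, ← Real.exp_nat_mul,
        Real.exp_le_exp]
      simp only [hlam]
      set r := Real.sqrt (A.logFactor k / c) with hr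
      have hr2 : r ^ 2 * c = 2 * Real.log x := by
        rw [hr, Real.sq_sqrt (div_nonneg (by linarith) hc0.le), div_mul_cancel₀ _ hc0.ne', hlog]
      have hrs : r * Real.sqrt (c * A.logFactor k) = 2 * Real.log x := by
        rw [hr, ← Real.sqrt_mul (div_nonneg (by linarith) hc0.le), ← hlog]
        have : A.logFactor k / c * (c * A.logFactor k) = A.logFactor k ^ 2 := by
          field_simp
        rw [this, Real.sqrt_sq (by linarith)]
      have hr0 : 0 ≤ r := Real.sqrt_nonneg _
      have h5 : r * Real.sqrt (c * A.logFactor k) ≤ r * |D| :=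
        mul_le_mul_of_nonneg_left hlt.le hr0
      have h6 : σ * (4 * r) * D = 4 * (r * |D|) := by
        rw [← hσD]
        ring
      have h7 : (σ * (4 * r)) ^ 2 / 8 * c = 2 * (r ^ 2 * c) := by
        rw [mul_pow, hσ2]
        ring
      rw [h6, h7, hr2]
      push_cast
      linarith
  have hbound : ∀ q ∈ idx, P {ω | ENNReal.ofReal (x ^ 4) ≤ ENNReal.ofReal (Real.exp
        (saleExponent A (cdf ν) vstar k q.2.1 q.2.2.1 (lam q.2.2.2) (tr ω) q.1))} ≤
      ENNReal.ofReal ((x ^ 4)⁻¹) := by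
    intro q hq
    have hq1 := Finset.mem_Ioc.1 (Finset.mem_product.1 hq).1
    obtain ⟨hmeas, hint⟩ := hM.lintegral_exp_saleExponent_le hB hv hO hrun hL hlip hk hks q.2.1
      q.2.2.1 (lam q.2.2.2) hq1.1 hq1.2
    refine (meas_ge_le_lintegral_div (hmeas.mono (hM.history_le _) le_rfl).aemeasurable
      (ENNReal.ofReal_pos.2 (by positivity)).ne' ENNReal.ofReal_ne_top).trans ?_
    rw [ENNReal.ofReal_inv_of_pos (by positivity), ← one_div]
    exact ENNReal.div_le_div_right hint _
  refine (measure_mono hsub).trans ((measure_biUnion_finset_le _ _).trans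
    ((Finset.sum_le_card_nsmul _ _ _ hbound).trans ?_))
  rw [hcard, nsmul_eq_mul, ← ENNReal.ofReal_natCast, ← ENNReal.ofReal_mul (Nat.cast_nonneg _)]
  refine ENNReal.ofReal_le_ofReal ?_
  rw [← div_eq_mul_inv, div_le_iff₀ (by positivity)]
  push_cast
  have h8 : (n : ℝ) ≤ x * A.δ := by linarith
  -- The number of events is `n · (x δ) ≤ (x δ)²`, so the failure probability `x^{-4}` of each
  -- leaves room to spare.
  have h9 : (n : ℝ) * (S * (N * (n * 2))) ≤ (x * A.δ) * (x * A.δ) := by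
    rw [show (n : ℝ) * (S * (N * (n * 2))) = n * (x * A.δ) by rw [hxδ]; ring]
    exact mul_le_mul_of_nonneg_right h8 (by positivity)
  refine h9.trans ?_
  have h10 : x ^ 2 ≤ x ^ 4 := pow_le_pow_right₀ hx1.le (by norm_num)
  have h11 : A.δ ^ 2 ≤ A.δ := by nlinarith
  calc x * A.δ * (x * A.δ) = A.δ ^ 2 * x ^ 2 := by ring
    _ ≤ A.δ * x ^ 4 := mul_le_mul h11 h10 (by positivity) hδ.le

end Concentration

/-! ### The exploration samples -/

/-- Uniform prices turn a binary sale into an unbiased label. It is applied to `c = vstar x + e`,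
which lies in `[0, B]` by the margin `b` around the valuations. -/
theorem integral_uniform_sale {B c : ℝ} (hB : 0 < B) (hc0 : 0 ≤ c) (hcB : c ≤ B) :
    ∫ u, B * ind (decide (u ≤ c)) ∂(ProbabilityTheory.cond volume (Set.Ioo 0 B)) = c := by
  have h1 : (fun u => ind (decide (u ≤ c))) = (Set.Iic c).indicator 1 := by
    ext u
    simp [ind, Set.indicator_apply]
  rw [integral_const_mul, h1, integral_indicator_one measurableSet_Iic,
    measureReal_def, cond_apply measurableSet_Ioo, ENNReal.toReal_mul, ENNReal.toReal_inv,
    ← measureReal_def, ← measureReal_def]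
  have h2 : (volume : Measure ℝ).real (Set.Ioo 0 B ∩ Set.Iic c) = c := by
    rcases hcB.lt_or_eq with h | rfl
    · have : Set.Ioo 0 B ∩ Set.Iic c = Set.Ioc 0 c := by
        ext u
        simp only [Set.mem_inter_iff, Set.mem_Ioo, Set.mem_Iic, Set.mem_Ioc]
        constructor
        · exact fun h => ⟨h.1.1, h.2⟩
        · exact fun h' => ⟨⟨h'.1, h'.2.trans_lt h⟩, h'.2⟩
      rw [this, Real.volume_real_Ioc_of_le hc0, sub_zero]
    · rw [Set.inter_eq_left.2 fun u hu => hu.2.le, Real.volume_real_Ioo_of_le hc0, sub_zero]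
  rw [h2, Real.volume_real_Ioo_of_le hB.le, sub_zero, ← mul_assoc, mul_inv_cancel₀ hB.ne', one_mul]

theorem not_inUCB_of_mem_explore {X : Type*} {A : AlgInput X} {k t : ℕ} (hk : 1 ≤ k)
    (h1 : 2 ^ (k - 1) < t) (h2 : t ≤ A.expEnd k) : ¬ A.InUCB t := by
  intro h
  have := h.2
  rw [episode_eq hk h1 (h2.trans (expEnd_le hk))] at this
  omega

section Exploration

variable {X : Type*} [MeasurableSpace X] {B b : ℝ} {μX : Measure X} {ν : Measure ℝ}
  {vstar : X → ℝ}

/-- The sample of an exploration round. -/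
noncomputable def exploreSample (vstar : X → ℝ) (z : X × ℝ × ℝ) : X × Bool :=
  (z.1, decide (z.2.2 ≤ vstar z.1 + z.2.1))

theorem measurable_exploreSample (hv : Measurable vstar) : Measurable (exploreSample vstar) := by
  refine measurable_fst.prodMk (measurable_to_bool ?_)
  have : (fun z : X × ℝ × ℝ => decide (z.2.2 ≤ vstar z.1 + z.2.1)) ⁻¹' {true} =
      {z | z.2.2 ≤ vstar z.1 + z.2.1} := by
    ext z
    simp
  rw [this]
  exact measurableSet_le (by fun_prop) (by fun_prop)

variable [IsProbabilityMeasure μX] [IsProbabilityMeasure ν]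

theorem measurable_ind : Measurable ind := measurable_from_top

theorem integrable_mul_ind {Z : Type*} [MeasurableSpace Z] {μ : Measure Z} [IsFiniteMeasure μ]
    {f : Z → Bool} (hf : Measurable f) : Integrable (fun z => B * ind (f z)) μ := by
  refine Integrable.const_mul (Integrable.of_mem_Icc 0 1 (measurable_ind.comp hf).aemeasurable
    (Filter.Eventually.of_forall fun z => ⟨ind_nonneg _, ind_le_one _⟩)) B

theorem integral_exploreSample (hv : Measurable vstar) (hB : 0 < B) (hb : ∀ᵐ e ∂ν, |e| ≤ b)
    (hmean : ∫ e, e ∂ν = 0) {x : X} (hx : b ≤ vstar x ∧ vstar x ≤ B - b) :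
    ∫ w, B * ind (exploreSample vstar (x, w)).2
      ∂(ν.prod (ProbabilityTheory.cond volume (Set.Ioo 0 B))) = vstar x := by
  have := isProbabilityMeasure_cond_Ioo hB
  have hm : Measurable fun w : ℝ × ℝ => (exploreSample vstar (x, w)).2 :=
    measurable_snd.comp ((measurable_exploreSample hv).comp measurable_prodMk_left)
  rw [integral_prod _ (integrable_mul_ind hm)]
  have h1 : ∀ᵐ e ∂ν, ∫ u, B * ind (exploreSample vstar (x, (e, u))).2
      ∂(ProbabilityTheory.cond volume (Set.Ioo 0 B)) = vstar x + e := by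
    filter_upwards [hb] with e he
    have := abs_le.1 he
    exact integral_uniform_sale (c := vstar x + e) hB (by linarith [hx.1]) (by linarith [hx.2])
  have hint : Integrable (fun e : ℝ => e) ν :=
    Integrable.of_mem_Icc (-b) b measurable_id.aemeasurable (hb.mono fun e he => abs_le.1 he)
  rw [integral_congr_ae h1, integral_add (integrable_const _) hint, hmean]
  simp

theorem condExp_exploreSample (hv : Measurable vstar) (hB : 0 < B) (hb : ∀ᵐ e ∂ν, |e| ≤ b)
    (hmean : ∫ e, e ∂ν = 0) (hvb : ∀ x, b ≤ vstar x ∧ vstar x ≤ B - b) (D : Measure (X × Bool))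
    [IsProbabilityMeasure D]
    (hD : D = (μX.prod (ν.prod (ProbabilityTheory.cond volume (Set.Ioo 0 B)))).map
      (exploreSample vstar)) :
    D[fun z => B * ind z.2 | MeasurableSpace.comap Prod.fst inferInstance]
        =ᵐ[D] (fun z => vstar z.1) := by
  have := isProbabilityMeasure_cond_Ioo hB
  have hg := measurable_exploreSample hv
  have hvD : ∀ (μ : Measure (X × Bool)) [IsFiniteMeasure μ], Integrable (fun z => vstar z.1) μ :=
    fun μ _ => Integrable.of_mem_Icc b (B - b) (hv.comp measurable_fst).aemeasurable
      (Filter.Eventually.of_forall fun z => hvb z.1)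
  have hm : MeasurableSpace.comap (Prod.fst : X × Bool → X) inferInstance ≤
      Prod.instMeasurableSpace :=
    measurable_fst.comap_le
  symm
  refine ae_eq_condExp_of_forall_setIntegral_eq hm (integrable_mul_ind measurable_snd)
    (fun s _ _ => hvD _) ?_ ?_
  -- Sets of the context σ-algebra pull back to `a ×ˢ univ`, where Fubini averages over noise and
  -- price for a fixed context.
  · rintro _ ⟨a, ha, rfl⟩ -
    have hs : MeasurableSet (Prod.fst ⁻¹' a : Set (X × Bool)) := measurable_fst ha
    have hpre : exploreSample vstar ⁻¹' (Prod.fst ⁻¹' a) = a ×ˢ (Set.univ : Set (ℝ × ℝ)) := by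
      ext z
      simp [exploreSample]
    have hvm : Measurable fun z : X × Bool => vstar z.1 := hv.comp measurable_fst
    have hsm : Measurable fun z : X × ℝ × ℝ => (exploreSample vstar z).2 :=
      measurable_snd.comp hg
    have hmi : Measurable fun z : X × Bool => B * ind z.2 :=
      (measurable_ind.comp measurable_snd).const_mul B
    rw [hD, setIntegral_map hs hvm.aestronglyMeasurable hg.aemeasurable,
      setIntegral_map hs hmi.aestronglyMeasurable hg.aemeasurable, hpre, ← Measure.prod_restrict,
      Measure.restrict_univ, integral_prod (fun z => B * ind (exploreSample vstar z).2)
        (integrable_mul_ind hsm),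
      integral_prod]
    · refine integral_congr_ae (Filter.Eventually.of_forall fun x => ?_)
      simp only
      rw [integral_exploreSample hv hB hb hmean (hvb x)]
      simp [exploreSample]
    · exact Integrable.of_mem_Icc b (B - b) (hv.comp measurable_fst).aemeasurable
        (Filter.Eventually.of_forall fun z => hvb z.1)
  · exact (hv.comp (comap_measurable Prod.fst)).stronglyMeasurable.aestronglyMeasurable

variable {Ω : Type*} [mΩ : MeasurableSpace Ω] {P : Measure Ω}
  {ε : ℕ → Ω → ℝ} {tr : Ω → Trajectory X} {A : AlgInput X}

/-- Almost surely, all prices of exploration rounds lie in `(0, B)`. -/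
theorem IsPricingModel.ae_unif_mem (hM : IsPricingModel P B μX ν vstar ε tr) (hB : 0 < B) :
    ∀ᵐ ω ∂P, ∀ t, (tr ω).unif t ∈ Set.Ioo 0 B := by
  have := isProbabilityMeasure_cond_Ioo hB
  rw [ae_all_iff]
  intro t
  have hlaw : P.map (fun ω => (tr ω).unif t) = ProbabilityTheory.cond volume (Set.Ioo 0 B) := by
    have h : (fun ω => (tr ω).unif t) = (Prod.snd ∘ Prod.snd) ∘ draw tr ε t := rfl
    rw [h, ← Measure.map_map (measurable_snd.comp measurable_snd) (hM.measurable_draw t)]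
    unfold draw
    rw [hM.law t, ← Measure.map_map measurable_snd measurable_snd,
      Measure.map_snd_prod, measure_univ, one_smul, Measure.map_snd_prod, measure_univ, one_smul]
  refine ae_of_ae_map (hM.meas_unif t).aemeasurable (p := fun u => u ∈ Set.Ioo 0 B) ?_
  rw [hlaw]
  exact ae_cond_mem measurableSet_Ioo

variable [IsProbabilityMeasure P]

/-- The predictor of an episode is inaccurate with probability at most `δ`. -/
theorem IsPricingModel.measure_not_predictor_le (hM : IsPricingModel P B μX ν vstar ε tr)
    (hB : 0 < B) (hv : Measurable vstar) (hb : ∀ᵐ e ∂ν, |e| ≤ b)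
    (hmean : ∫ e, e ∂ν = 0) (hvb : ∀ x, b ≤ vstar x ∧ vstar x ≤ B - b)
    (hrun : ∀ ω, A.IsRun (tr ω)) {k : ℕ} (hk : 1 ≤ k) {r : ℝ} {η : ENNReal}
    (hor : ∀ D : Measure (X × Bool), IsProbabilityMeasure D → D.map Prod.fst = μX →
      D[fun z => B * ind z.2 | MeasurableSpace.comap Prod.fst inferInstance]
        =ᵐ[D] (fun z => vstar z.1) →
      Measure.pi (fun _ : Fin (A.expLen k) => D)
        {data | ¬ ∀ x, |A.oracle (A.expLen k) data x - vstar x| ≤ r} ≤ η) :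
    P {ω | ¬ ∀ x, |A.vHat (tr ω) k x - vstar x| ≤ r} ≤ η := by
  have := isProbabilityMeasure_cond_Ioo hB
  have hg := measurable_exploreSample hv
  set D := (μX.prod (ν.prod (ProbabilityTheory.cond volume (Set.Ioo 0 B)))).map
      (exploreSample vstar) with hD
  have hDp : IsProbabilityMeasure D := Measure.isProbabilityMeasure_map hg.aemeasurable
  have hfst : D.map Prod.fst = μX := by
    rw [hD, Measure.map_map measurable_fst hg]
    have : Prod.fst ∘ exploreSample vstar = Prod.fst := rfl
    rw [this, Measure.map_fst_prod, measure_univ, one_smul]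
  have h := hor D hDp hfst (condExp_exploreSample hv hB hb hmean hvb D hD)
  set f : Fin (A.expLen k) → Ω → X × Bool := fun i ω =>
    exploreSample vstar (draw tr ε (2 ^ (k - 1) + 1 + i) ω) with hf
  have hfm : ∀ i, Measurable (f i) := fun i => hg.comp (hM.measurable_draw _)
  have hind : iIndepFun f P := by
    have h1 : iIndepFun (draw tr ε) P := hM.indep
    have h2 := h1.precomp (g := fun i : Fin (A.expLen k) => 2 ^ (k - 1) + 1 + (i : ℕ))
      fun i j hij => Fin.ext (by simpa using hij)
    exact h2.comp (fun _ => exploreSample vstar) fun _ => hg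
  have hmap : ∀ i, P.map (f i) = D := by
    intro i
    have : f i = exploreSample vstar ∘ draw tr ε (2 ^ (k - 1) + 1 + i) := rfl
    rw [this, ← Measure.map_map hg (hM.measurable_draw _), hD]
    congr 1
    exact hM.law _
  have hpi : P.map (fun ω i => f i ω) = Measure.pi fun _ => D := by
    rw [(iIndepFun_iff_map_fun_eq_pi_map fun i => (hfm i).aemeasurable).1 hind]
    simp only [hmap]
  -- Exploration rounds post the auxiliary draw, also when they fall into the warm-up, so the
  -- recorded data are a fixed function of i.i.d. draws.
  have hvHat : ∀ ω x, A.vHat (tr ω) k x = A.oracle (A.expLen k) (fun i => f i ω) x := by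
    intro ω x
    unfold vHat
    congr 2
    funext i
    set t := 2 ^ (k - 1) + 1 + (i : ℕ) with ht
    have h1 : 2 ^ (k - 1) < t := by omega
    have h2 : t ≤ A.expEnd k := by
      have := i.2
      unfold expEnd
      omega
    have h3 := (hrun ω t ((Nat.zero_le _).trans_lt h1)).1 (not_inUCB_of_mem_explore hk h1 h2)
    have h4 := hM.sale_iff t ω
    rw [h3] at h4
    refine Prod.ext rfl ?_
    show (tr ω).sale t = decide ((tr ω).unif t ≤ vstar ((tr ω).ctx t) + ε t ω)
    rw [Bool.eq_iff_iff, h4, decide_eq_true_iff]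
  rw [← hpi] at h
  refine le_trans ?_ h
  simp only [hvHat]
  -- This inequality needs no measurability of the bad set, a condition over possibly uncountably
  -- many contexts.
  exact Measure.le_map_apply (measurable_pi_lambda _ hfm).aemeasurable _

end Exploration

/-! ### Numerical estimates -/

theorem rpow_third_cube {x : ℝ} (hx : 0 ≤ x) : (x ^ (1 / 3 : ℝ)) ^ 3 = x := by
  rw [← Real.rpow_natCast, ← Real.rpow_mul hx]
  norm_num

theorem rpow_two_thirds {x : ℝ} (hx : 0 ≤ x) : x ^ (2 / 3 : ℝ) = (x ^ (1 / 3 : ℝ)) ^ 2 := by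
  rw [← Real.rpow_natCast, ← Real.rpow_mul hx]
  norm_num

section Numeric

variable {X : Type*} {A : AlgInput X} {T k : ℕ}

theorem one_le_log_div {δ : ℝ} (hT : 2 ≤ T) (hδ : 0 < δ) (hδ2 : δ < 1 / 2) :
    4 ≤ T / δ ∧ 1 ≤ Real.log (T / δ) := by
  have hT' : (2 : ℝ) ≤ T := by exact_mod_cast hT
  have h4 : 4 ≤ T / δ := by
    rw [le_div_iff₀ hδ]
    linarith
  refine ⟨h4, ?_⟩
  rw [Real.le_log_iff_exp_le (by linarith)]
  linarith [Real.exp_one_lt_d9]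

theorem log_le_log_div {δ : ℝ} (hT : 2 ≤ T) (hδ : 0 < δ) (hδ2 : δ < 1 / 2) :
    Real.log T ≤ Real.log (T / δ) := by
  have hT' : (2 : ℝ) ≤ T := by exact_mod_cast hT
  refine Real.log_le_log (by linarith) ?_
  rw [le_div_iff₀ hδ]
  nlinarith

theorem logb_two_le {δ : ℝ} (hT : 2 ≤ T) (hδ : 0 < δ) (hδ2 : δ < 1 / 2) :
    Real.logb 2 T ≤ 2 * Real.log (T / δ) := by
  have h := log_le_log_div hT hδ hδ2
  have h1 := (one_le_log_div hT hδ hδ2).2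
  rw [Real.logb, div_le_iff₀ (Real.log_pos one_lt_two)]
  nlinarith [Real.log_two_gt_d9]

theorem natCeil_logb_two_le {δ : ℝ} (hT : 2 ≤ T) (hδ : 0 < δ) (hδ2 : δ < 1 / 2) :
    (⌈Real.logb 2 (T : ℝ)⌉₊ : ℝ) ≤ 3 * Real.log (T / δ) := by
  have hT' : (2 : ℝ) ≤ T := by exact_mod_cast hT
  have h1 := (one_le_log_div hT hδ hδ2).2
  have h2 := logb_two_le hT hδ hδ2
  have := (Nat.ceil_lt_add_one (Real.logb_nonneg one_lt_two (show (1 : ℝ) ≤ T by linarith))).le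
  linarith

theorem one_le_rpow_mul (hT : 1 ≤ T) (hρ : 1 ≤ A.ρ) :
    (T : ℝ) ^ (2 / 3 : ℝ) ≤ A.ρ ^ (1 / 3 : ℝ) * (T : ℝ) ^ (2 / 3 : ℝ) :=
  le_mul_of_one_le_left (by positivity) (Real.one_le_rpow hρ (by norm_num))

theorem expLen_le (hρ : 1 ≤ A.ρ) (hk : 2 ^ (k - 1) ≤ T) :
    (A.expLen k : ℝ) ≤ 2 * (A.ρ ^ (1 / 3 : ℝ) * (T : ℝ) ^ (2 / 3 : ℝ)) := by
  have hell : (1 : ℝ) ≤ ell k := by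
    unfold ell
    exact_mod_cast Nat.one_le_two_pow
  have hellT : ((ell k : ℕ) : ℝ) ≤ T := by
    unfold ell
    exact_mod_cast hk
  have ha : 1 ≤ A.ρ ^ (1 / 3 : ℝ) := Real.one_le_rpow hρ (by norm_num)
  have hb : 1 ≤ ((ell k : ℕ) : ℝ) ^ (2 / 3 : ℝ) := Real.one_le_rpow hell (by norm_num)
  have hab := one_le_mul_of_one_le_of_one_le hb ha
  have hbT : ((ell k : ℕ) : ℝ) ^ (2 / 3 : ℝ) ≤ (T : ℝ) ^ (2 / 3 : ℝ) :=
    Real.rpow_le_rpow (by linarith) hellT (by norm_num)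
  have h1 : (A.expLen k : ℝ) ≤ ⌈((ell k : ℕ) : ℝ) ^ (2 / 3 : ℝ) * A.ρ ^ (1 / 3 : ℝ)⌉₊ := by
    exact_mod_cast min_le_right _ _
  have h2 := (Nat.ceil_lt_add_one (show 0 ≤ ((ell k : ℕ) : ℝ) ^ (2 / 3 : ℝ) * A.ρ ^ (1 / 3 : ℝ) by
    positivity)).le
  have h3 : ((ell k : ℕ) : ℝ) ^ (2 / 3 : ℝ) * A.ρ ^ (1 / 3 : ℝ) ≤
      (T : ℝ) ^ (2 / 3 : ℝ) * A.ρ ^ (1 / 3 : ℝ) := mul_le_mul_of_nonneg_right hbT (by linarith)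
  linarith

/-- Error bound of the predictor of episode `k`. -/
noncomputable def predError (A : AlgInput X) (k : ℕ) : ℝ := Real.sqrt (A.ρ / A.expLen k)

/-- A nonempty UCB phase means that the cap on exploration is inactive. With `a = ρ^{1/3}` and `b =
ℓ^{1/3}` this gives `b² a ≤ expLen < b³`, hence `a < b`, an error of at most `a / b`, and a total of
at most `b³ · a / b = a b²`. -/
theorem predError_bounds (hρ : 1 ≤ A.ρ) (hk : 2 ^ (k - 1) ≤ T) (hU : 0 < A.ucbLen k) :
    predError A k ≤ 1 ∧
      A.ucbLen k * predError A k ≤ A.ρ ^ (1 / 3 : ℝ) * (T : ℝ) ^ (2 / 3 : ℝ) := by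
  have hell : (1 : ℝ) ≤ ell k := by
    unfold ell
    exact_mod_cast Nat.one_le_two_pow
  have hellT : ((ell k : ℕ) : ℝ) ≤ T := by
    unfold ell
    exact_mod_cast hk
  have hlt : A.expLen k < ell k := Nat.sub_pos_iff_lt.1 hU
  have hceil : A.expLen k = ⌈((ell k : ℕ) : ℝ) ^ (2 / 3 : ℝ) * A.ρ ^ (1 / 3 : ℝ)⌉₊ :=
    (min_choice _ _).resolve_left hlt.ne
  have hge : ((ell k : ℕ) : ℝ) ^ (2 / 3 : ℝ) * A.ρ ^ (1 / 3 : ℝ) ≤ A.expLen k := by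
    rw [hceil]
    exact Nat.le_ceil _
  have hlt' : (A.expLen k : ℝ) < ell k := by exact_mod_cast hlt
  have hbT : ((ell k : ℕ) : ℝ) ^ (2 / 3 : ℝ) ≤ (T : ℝ) ^ (2 / 3 : ℝ) :=
    Real.rpow_le_rpow (by linarith) hellT (by norm_num)
  have hUle : (A.ucbLen k : ℝ) ≤ ell k := by exact_mod_cast Nat.sub_le _ _
  have ha : 1 ≤ A.ρ ^ (1 / 3 : ℝ) := Real.one_le_rpow hρ (by norm_num)
  have hb : 1 ≤ ((ell k : ℕ) : ℝ) ^ (1 / 3 : ℝ) := Real.one_le_rpow hell (by norm_num)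
  have ha3 := rpow_third_cube (show 0 ≤ A.ρ by linarith)
  have hb3 := rpow_third_cube (show (0 : ℝ) ≤ ell k by linarith)
  rw [rpow_two_thirds (by linarith)] at hge hbT
  set a := A.ρ ^ (1 / 3 : ℝ)
  set b := ((ell k : ℕ) : ℝ) ^ (1 / 3 : ℝ)
  have hab : a < b := by
    have : b ^ 2 * a < b ^ 2 * b := by
      calc b ^ 2 * a ≤ A.expLen k := hge
        _ < ell k := hlt'
        _ = b ^ 2 * b := by rw [← hb3]; ring
    exact lt_of_mul_lt_mul_left this (by positivity)
  have he : predError A k ≤ a / b := by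
    refine Real.sqrt_le_iff.2 ⟨by positivity, ?_⟩
    rw [div_pow, div_le_div_iff₀ (lt_of_lt_of_le (by positivity) hge) (by positivity), ← ha3]
    calc a ^ 3 * b ^ 2 = a ^ 2 * (b ^ 2 * a) := by ring
      _ ≤ a ^ 2 * A.expLen k := mul_le_mul_of_nonneg_left hge (by positivity)
  refine ⟨he.trans (div_le_one_of_le₀ hab.le (by linarith)), ?_⟩
  calc A.ucbLen k * predError A k ≤ b ^ 3 * (a / b) :=
        mul_le_mul (hb3 ▸ hUle) he (Real.sqrt_nonneg _) (by positivity)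
    _ = a * b ^ 2 := by field_simp
    _ ≤ _ := mul_le_mul_of_nonneg_left hbT (by linarith)

theorem ucbLen_le (hk : 2 ^ (k - 1) ≤ T) : A.ucbLen k ≤ T := (Nat.sub_le _ _).trans hk

theorem numLayers_le (hT : 2 ≤ T) (hk : 2 ^ (k - 1) ≤ T) (hδ : 0 < A.δ) (hδ2 : A.δ < 1 / 2)
    (hU : 0 < A.ucbLen k) : (A.numLayers k : ℝ) ≤ 2 * Real.log (T / A.δ) := by
  have h1 := (one_le_log_div hT hδ hδ2).2
  have h2 := logb_two_le hT hδ hδ2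
  have hU' : (1 : ℝ) ≤ A.ucbLen k := by exact_mod_cast hU
  have hUT : (A.ucbLen k : ℝ) ≤ T := by exact_mod_cast ucbLen_le hk
  have h3 : Real.logb 2 (A.ucbLen k) ≤ Real.logb 2 T :=
    Real.logb_le_logb_of_le one_lt_two (by linarith) hUT
  have h4 := (Nat.ceil_lt_add_one (show 0 ≤ (1 / 2 : ℝ) * Real.logb 2 (A.ucbLen k) from
    mul_nonneg (by norm_num) (Real.logb_nonneg one_lt_two hU'))).le
  rw [numLayers, Nat.cast_max, Nat.cast_one]
  exact max_le (by linarith) (by linarith)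

/-- With `c = len^{1/3}` and `g` the cube root of the logarithm, `c / g ≤ N ≤ 3c` because `g ≥ 1/2`
and `c ≥ 1`. The first two bounds serve the discretisation and the bandit term. -/
theorem gridSize_bounds (hT : 2 ≤ T) (hk : 2 ^ (k - 1) ≤ T) (hδ : 0 < A.δ) (hδ2 : A.δ < 1 / 2)
    (hU : 0 < A.ucbLen k) :
    (A.ucbLen k : ℝ) / A.gridSize k ≤ Real.log (T / A.δ) * (T : ℝ) ^ (2 / 3 : ℝ) ∧
    (A.ucbLen k : ℝ) * A.gridSize k ≤ 3 * ((T : ℝ) ^ (2 / 3 : ℝ)) ^ 2 ∧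
    (A.gridSize k : ℝ) ≤ 3 * T := by
  have h1 := (one_le_log_div hT hδ hδ2).2
  have hU' : (1 : ℝ) ≤ A.ucbLen k := by exact_mod_cast hU
  have hUT : (A.ucbLen k : ℝ) ≤ T := by exact_mod_cast ucbLen_le hk
  have hc1 : 1 ≤ (A.ucbLen k : ℝ) ^ (1 / 3 : ℝ) := Real.one_le_rpow hU' (by norm_num)
  have hc3 := rpow_third_cube (show (0 : ℝ) ≤ A.ucbLen k by linarith)
  have hcT : (A.ucbLen k : ℝ) ^ (2 / 3 : ℝ) ≤ (T : ℝ) ^ (2 / 3 : ℝ) :=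
    Real.rpow_le_rpow (by linarith) hUT (by norm_num)
  rw [rpow_two_thirds (by linarith)] at hcT
  have hlog1 : Real.log (A.ucbLen k / A.δ) ≤ Real.log (T / A.δ) :=
    Real.log_le_log (by positivity) (div_le_div_of_nonneg_right hUT hδ.le)
  have hlog0 : 1 / 2 ≤ Real.log (A.ucbLen k / A.δ) := by
    have h2 : Real.log 2 ≤ Real.log (A.ucbLen k / A.δ) := by
      refine Real.log_le_log (by norm_num) ?_
      rw [le_div_iff₀ hδ]
      linarith
    linarith [Real.log_two_gt_d9]
  have hg3 := rpow_third_cube (show 0 ≤ Real.log (A.ucbLen k / A.δ) by linarith)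
  have hg0 : 0 ≤ Real.log (A.ucbLen k / A.δ) ^ (1 / 3 : ℝ) := by positivity
  have hN : A.gridSize k = ⌈(A.ucbLen k : ℝ) ^ (1 / 3 : ℝ) /
    Real.log (A.ucbLen k / A.δ) ^ (1 / 3 : ℝ)⌉₊ := rfl
  set c := (A.ucbLen k : ℝ) ^ (1 / 3 : ℝ)
  set g := Real.log (A.ucbLen k / A.δ) ^ (1 / 3 : ℝ)
  have hghalf : 1 / 2 ≤ g := by
    by_contra hcon
    have := pow_le_pow_left₀ hg0 (not_le.1 hcon).le 3
    norm_num at this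
    linarith
  have hgΛ : g ≤ Real.log (T / A.δ) := by
    rcases le_total g 1 with h | h
    · linarith
    · have : g ^ 1 ≤ g ^ 3 := pow_le_pow_right₀ h (by norm_num)
      linarith
  have hgpos : 0 < g := by linarith
  have hN1 : c / g ≤ A.gridSize k := by
    rw [hN]
    exact Nat.le_ceil _
  have hN2 : (A.gridSize k : ℝ) ≤ 3 * c := by
    have h4 := (Nat.ceil_lt_add_one (show 0 ≤ c / g by positivity)).le
    rw [← hN] at h4
    have h5 : c / g ≤ 2 * c := by
      rw [div_le_iff₀ hgpos]
      nlinarith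
    linarith
  have hNpos : (0 : ℝ) < A.gridSize k := lt_of_lt_of_le (by positivity) hN1
  refine ⟨?_, ?_, ?_⟩
  · rw [div_le_iff₀ hNpos]
    calc (A.ucbLen k : ℝ) = g * c ^ 2 * (c / g) := by rw [← hc3]; field_simp
      _ ≤ Real.log (T / A.δ) * (T : ℝ) ^ (2 / 3 : ℝ) * A.gridSize k := by gcongr
  · calc (A.ucbLen k : ℝ) * A.gridSize k ≤ c ^ 3 * (3 * c) := by rw [hc3]; gcongr
      _ = 3 * (c ^ 2) ^ 2 := by ring
      _ ≤ _ := by gcongr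
  · have : c ^ 1 ≤ c ^ 3 := pow_le_pow_right₀ hc1 (by norm_num)
    linarith

theorem abs_logFactor_le (hT : 2 ≤ T) (hk : 2 ^ (k - 1) ≤ T) (hδ : 0 < A.δ)
    (hδ2 : A.δ < 1 / 2) (hU : 0 < A.ucbLen k) :
    |A.logFactor k| ≤ 10 * Real.log (T / A.δ) := by
  obtain ⟨h4, h1⟩ := one_le_log_div hT hδ hδ2
  have hT' : (2 : ℝ) ≤ T := by exact_mod_cast hT
  have hU' : (1 : ℝ) ≤ A.ucbLen k := by exact_mod_cast hU
  have hUT : (A.ucbLen k : ℝ) ≤ T := by exact_mod_cast ucbLen_le hk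
  have hS1 : (1 : ℝ) ≤ A.numLayers k := by exact_mod_cast one_le_numLayers k
  have hS : (A.numLayers k : ℝ) ≤ 2 * (T / A.δ) :=
    (numLayers_le hT hk hδ hδ2 hU).trans
      (by linarith [Real.log_le_self (x := T / A.δ) (by linarith)])
  have hN := (gridSize_bounds hT hk hδ hδ2 hU).2.2
  have hTδ : (T : ℝ) ≤ T / A.δ := by
    rw [le_div_iff₀ hδ]
    nlinarith
  have hN0 : (1 : ℝ) ≤ A.gridSize k := by
    have : A.gridSize k ≠ 0 := by
      rw [gridSize, Nat.ne_zero_iff_zero_lt, Nat.ceil_pos]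
      have : 0 < Real.log (A.ucbLen k / A.δ) := Real.log_pos (by
        rw [lt_div_iff₀ hδ]
        linarith)
      positivity
    exact_mod_cast Nat.one_le_iff_ne_zero.2 this
  set x := 2 * A.numLayers k * A.gridSize k * A.ucbLen k / A.δ with hx
  have hlow : 1 ≤ x := by
    rw [hx, le_div_iff₀ hδ]
    have := one_le_mul_of_one_le_of_one_le (one_le_mul_of_one_le_of_one_le hS1 hN0) hU'
    linarith
  have hup : x ≤ (T / A.δ) ^ 5 := by
    -- The factors give `2 · 2y · 3y · y = 12 y³`, and `y ≥ 4` absorbs the `12` into `y²`.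
    set y := T / A.δ with hy
    have h12 : 12 * y ^ 3 ≤ y ^ 2 * y ^ 3 := by
      gcongr
      nlinarith
    have hUδ : A.ucbLen k / A.δ ≤ y := div_le_div_of_nonneg_right hUT hδ.le
    calc x = 2 * A.numLayers k * A.gridSize k * (A.ucbLen k / A.δ) := by rw [hx]; ring
      _ ≤ 2 * (2 * y) * (3 * y) * y := by
          gcongr
          linarith
      _ = 12 * y ^ 3 := by ring
      _ ≤ y ^ 5 := by rw [← pow_add] at h12; exact h12
  have hl0 : 0 ≤ Real.log x := Real.log_nonneg hlow
  have hl1 : Real.log x ≤ 5 * Real.log (T / A.δ) := by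
    have := Real.log_le_log (by linarith) hup
    rwa [Real.log_pow, Nat.cast_ofNat] at this
  have : A.logFactor k = 2 * Real.log x := rfl
  rw [this, abs_of_nonneg (by linarith)]
  linarith

/-- The warm-up has at most `ρ` rounds, and the minimum of `T` and `ρ` is below their weighted
geometric mean. This also covers horizons that end inside the warm-up. -/
theorem warmup_le (hρ : 1 ≤ A.ρ) :
    ((min T (2 ^ (A.kStar - 1)) : ℕ) : ℝ) ≤ A.ρ ^ (1 / 3 : ℝ) * (T : ℝ) ^ (2 / 3 : ℝ) := by
  have h1 : ((2 ^ (A.kStar - 1) : ℕ) : ℝ) ≤ A.ρ := by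
    rcases Nat.eq_zero_or_pos A.kStar with h | h
    · simpa [h] using hρ
    · have h2 : A.kStar - 1 < A.kStar := by omega
      have h3 := Nat.lt_ceil.1 h2
      rw [Real.lt_logb_iff_rpow_lt one_lt_two (by linarith), Real.rpow_natCast] at h3
      push_cast
      exact h3.le
  have hρ0 : 0 ≤ A.ρ := by linarith
  have hT0 : (0 : ℝ) ≤ T := Nat.cast_nonneg T
  have hρ3 := rpow_third_cube hρ0
  have hT3 := rpow_third_cube hT0
  have ha : 0 ≤ A.ρ ^ (1 / 3 : ℝ) := by positivity
  have hb : 0 ≤ (T : ℝ) ^ (1 / 3 : ℝ) := by positivity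
  rw [rpow_two_thirds hT0]
  rcases le_total A.ρ T with h | h
  · have hab : A.ρ ^ (1 / 3 : ℝ) ≤ (T : ℝ) ^ (1 / 3 : ℝ) :=
      Real.rpow_le_rpow hρ0 h (by norm_num)
    calc ((min T (2 ^ (A.kStar - 1)) : ℕ) : ℝ) ≤ A.ρ :=
          le_trans (by exact_mod_cast min_le_right _ _) h1
      _ = A.ρ ^ (1 / 3 : ℝ) * (A.ρ ^ (1 / 3 : ℝ)) ^ 2 := by rw [← pow_succ', hρ3]
      _ ≤ _ := by gcongr
  · have hab : (T : ℝ) ^ (1 / 3 : ℝ) ≤ A.ρ ^ (1 / 3 : ℝ) :=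
      Real.rpow_le_rpow hT0 h (by norm_num)
    calc ((min T (2 ^ (A.kStar - 1)) : ℕ) : ℝ) ≤ T := by exact_mod_cast min_le_left _ _
      _ = (T : ℝ) ^ (1 / 3 : ℝ) * ((T : ℝ) ^ (1 / 3 : ℝ)) ^ 2 := by rw [← pow_succ', hT3]
      _ ≤ _ := by gcongr

end Numeric

/-! ### Regret on the good event -/

section Regret

variable {X : Type*} {A : AlgInput X} {tr : Trajectory X} {F : ℝ → ℝ} {L b : ℝ} {vstar : X → ℝ}
  {T : ℕ}

/-- Leading constant of the regret of the UCB phase of an episode. -/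
noncomputable def ucbConst (B L : ℝ) : ℝ := (4 * B + 2) / B * (3 * B + 2) + 8 * (B * L) + 96 * B

theorem AlgInput.Concentrated.sum_regret_le (hF : IsNoiseCDF F L b) (hL : 0 ≤ L) (hB : 0 < A.B)
    (hb : 0 ≤ b) (hρ : 1 ≤ A.ρ) (hδ : 0 < A.δ) (hδ2 : A.δ < 1 / 2) (hT : 2 ≤ T)
    (hrun : A.IsRun tr) {k : ℕ} (hk : 1 ≤ k) (hks : A.kStar ≤ k) (hkT : 2 ^ (k - 1) ≤ T)
    (hv0 : ∀ x, 0 ≤ vstar x) (hvB : ∀ x, vstar x ≤ A.B - b)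
    (hc : A.Concentrated F vstar tr k) (hv : ∀ x, |A.vHat tr k x - vstar x| ≤ predError A k)
    {p : ℕ → ℝ} (hp : ∀ t, 0 ≤ p t) {V : Finset ℕ} (hV : V ⊆ A.ucbRounds k) :
    ∑ t ∈ V, (rev F (vstar (tr.ctx t)) (p t) - rev F (vstar (tr.ctx t)) (tr.price t)) ≤
      ucbConst A.B L * Real.log (T / A.δ) ^ 2 * (A.ρ ^ (1 / 3 : ℝ) * (T : ℝ) ^ (2 / 3 : ℝ)) := by
  obtain ⟨h4, hΛ⟩ := one_le_log_div hT hδ hδ2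
  set Λ := Real.log (T / A.δ) with hΛdef
  set Q := A.ρ ^ (1 / 3 : ℝ) * (T : ℝ) ^ (2 / 3 : ℝ) with hQ
  have hτ0 : 0 ≤ (T : ℝ) ^ (2 / 3 : ℝ) := by positivity
  have hτQ : (T : ℝ) ^ (2 / 3 : ℝ) ≤ Q := one_le_rpow_mul (by omega) hρ
  have hQ0 : 0 ≤ Q := hτ0.trans hτQ
  have hC0 : 0 ≤ ucbConst A.B L := by
    unfold ucbConst
    positivity
  rcases Nat.eq_zero_or_pos (A.ucbLen k) with h0 | hU
  · rw [← card_ucbRounds hk, Finset.card_eq_zero] at h0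
    rw [h0, Finset.subset_empty] at hV
    rw [hV, Finset.sum_empty]
    positivity
  obtain ⟨he1, heQ⟩ := predError_bounds hρ hkT hU
  obtain ⟨hN1, hN2, -⟩ := gridSize_bounds hT hkT hδ hδ2 hU
  have hS := numLayers_le hT hkT hδ hδ2 hU
  have hlf := abs_logFactor_le hT hkT hδ hδ2 hU
  rw [← hΛdef] at hN1 hS hlf
  have he0 : 0 ≤ predError A k := Real.sqrt_nonneg _
  set e := predError A k
  have hsum := hrun.sum_two_zpow_layer_le hk hks
  have hsqrt : Real.sqrt (A.ucbLen k * (A.gridSize k * (|A.logFactor k| + 1))) ≤ 6 * Λ * Q := by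
    refine Real.sqrt_le_iff.2 ⟨by positivity, ?_⟩
    calc (A.ucbLen k : ℝ) * (A.gridSize k * (|A.logFactor k| + 1))
        = A.ucbLen k * A.gridSize k * (|A.logFactor k| + 1) := by ring
      _ ≤ 3 * ((T : ℝ) ^ (2 / 3 : ℝ)) ^ 2 * (10 * Λ + 1) := by gcongr
      _ ≤ 3 * Q ^ 2 * (12 * Λ ^ 2) := by
          gcongr
          nlinarith
      _ = (6 * Λ * Q) ^ 2 := by ring
  have hlayers : ∑ t ∈ A.ucbRounds k, (2 : ℝ) ^ (-(tr.layer t : ℤ)) ≤ 12 * (Λ ^ 2 * Q) := by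
    refine hsum.trans ?_
    calc (A.numLayers k : ℝ) * Real.sqrt (A.ucbLen k * (A.gridSize k * (|A.logFactor k| + 1)))
        ≤ (2 * Λ) * (6 * Λ * Q) := by gcongr
      _ = 12 * (Λ ^ 2 * Q) := by ring
  set G := (4 * A.B + 2) / A.B * ((3 * A.B + 2) / A.gridSize k) +
    4 * (A.B * (L * e)) * A.numLayers k with hG
  have hG0 : 0 ≤ G := by positivity
  calc ∑ t ∈ V, (rev F (vstar (tr.ctx t)) (p t) - rev F (vstar (tr.ctx t)) (tr.price t))
      ≤ ∑ t ∈ V, (G + 8 * A.B * (2 : ℝ) ^ (-(tr.layer t : ℤ))) :=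
        Finset.sum_le_sum fun t ht => hc.regret_le hF hL hB hb he0 he1 hrun hk hks hv0 hvB hv
          (hV ht) (hp t)
    -- The horizon may cut the last episode; the per-round bound is nonnegative, so the sum may be
    -- extended to the whole phase.
    _ ≤ ∑ t ∈ A.ucbRounds k, (G + 8 * A.B * (2 : ℝ) ^ (-(tr.layer t : ℤ))) :=
        Finset.sum_le_sum_of_subset_of_nonneg hV fun t _ _ => by positivity
    _ = A.ucbLen k * G + 8 * A.B * ∑ t ∈ A.ucbRounds k, (2 : ℝ) ^ (-(tr.layer t : ℤ)) := by
        rw [Finset.sum_add_distrib, Finset.sum_const, card_ucbRounds hk, nsmul_eq_mul,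
          Finset.mul_sum]
    _ = (4 * A.B + 2) / A.B * (3 * A.B + 2) * (A.ucbLen k / A.gridSize k) +
        4 * (A.B * L) * (A.ucbLen k * e) * A.numLayers k +
        8 * A.B * ∑ t ∈ A.ucbRounds k, (2 : ℝ) ^ (-(tr.layer t : ℤ)) := by
        rw [hG]
        ring
    -- Discretisation, predictor bias over at most `2Λ` layers, and bandit learning: the three
    -- summands of `ucbConst`.
    _ ≤ (4 * A.B + 2) / A.B * (3 * A.B + 2) * (Λ * Q) +
        4 * (A.B * L) * Q * (2 * Λ) + 8 * A.B * (12 * (Λ ^ 2 * Q)) := by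
        have : (A.ucbLen k : ℝ) / A.gridSize k ≤ Λ * Q :=
          hN1.trans (mul_le_mul_of_nonneg_left hτQ (by linarith))
        gcongr
    _ ≤ ucbConst A.B L * Λ ^ 2 * Q := by
        have h5 : Λ * Q ≤ Λ ^ 2 * Q := by
          gcongr
          nlinarith
        have h6 : 0 ≤ (4 * A.B + 2) / A.B * (3 * A.B + 2) := by positivity
        have h7 : 0 ≤ A.B * L := by positivity
        have h8 := mul_le_mul_of_nonneg_left h5 h6
        have h9 := mul_le_mul_of_nonneg_left h5 h7
        unfold ucbConst
        nlinarith

theorem mem_explore_of_not_inUCB {t : ℕ} (ht : t ∈ Finset.Icc 1 T) (h : ¬ A.InUCB t) :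
    t ∈ Finset.Icc 1 (min T (2 ^ (A.kStar - 1))) ∪
      (Finset.Icc 1 (Nat.clog 2 T)).biUnion fun k => Finset.Ioc (2 ^ (k - 1)) (A.expEnd k) := by
  rw [Finset.mem_Icc] at ht
  rw [Finset.mem_union]
  rcases le_or_gt t (2 ^ (A.kStar - 1)) with h1 | h1
  · exact Or.inl (Finset.mem_Icc.2 ⟨ht.1, le_min ht.2 h1⟩)
  · right
    have h2 : 1 < t := lt_of_le_of_lt Nat.one_le_two_pow h1
    have h3 : 1 ≤ episode t := Nat.clog_pos (by norm_num) h2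
    refine Finset.mem_biUnion.2 ⟨episode t, Finset.mem_Icc.2
      ⟨h3, Nat.clog_mono_right 2 ht.2⟩, Finset.mem_Ioc.2 ⟨?_, ?_⟩⟩
    · exact (Nat.lt_clog_iff_pow_lt (by norm_num)).1 (show episode t - 1 < Nat.clog 2 t by
        unfold episode at *
        omega)
    · by_contra hcon
      exact h ⟨h1, not_le.1 hcon⟩

theorem two_pow_pred_le {k : ℕ} (hk : k ∈ Finset.Icc 1 (Nat.clog 2 T)) : 2 ^ (k - 1) ≤ T := by
  rw [Finset.mem_Icc] at hk
  exact ((Nat.lt_clog_iff_pow_lt (b := 2) (by norm_num)).1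
    (show k - 1 < Nat.clog 2 T by omega)).le

/-- The `1` pays for the warm-up and each `2` for the exploration phase of one episode. -/
theorem card_explore_le [DecidablePred A.InUCB] (hρ : 1 ≤ A.ρ) :
    (((Finset.Icc 1 T).filter fun t => ¬ A.InUCB t).card : ℝ) ≤
      (1 + 2 * Nat.clog 2 T) * (A.ρ ^ (1 / 3 : ℝ) * (T : ℝ) ^ (2 / 3 : ℝ)) := by
  classical
  have hsub : ((Finset.Icc 1 T).filter fun t => ¬ A.InUCB t) ⊆ _ := fun t ht =>
    mem_explore_of_not_inUCB (Finset.mem_filter.1 ht).1 (Finset.mem_filter.1 ht).2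
  have h1 := (Finset.card_le_card hsub).trans ((Finset.card_union_le _ _).trans
    (add_le_add_right Finset.card_biUnion_le _))
  have h2 : (((Finset.Icc 1 T).filter fun t => ¬ A.InUCB t).card : ℝ) ≤
      (min T (2 ^ (A.kStar - 1)) : ℕ) + ∑ k ∈ Finset.Icc 1 (Nat.clog 2 T), (A.expLen k : ℝ) := by
    have h3 : ∀ k, (Finset.Ioc (2 ^ (k - 1)) (A.expEnd k)).card = A.expLen k := fun k => by
      rw [Nat.card_Ioc, expEnd, Nat.add_sub_cancel_left]
    simp only [h3, Nat.card_Icc, Nat.add_sub_cancel] at h1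
    exact_mod_cast h1
  refine h2.trans ?_
  have h4 : ∑ k ∈ Finset.Icc 1 (Nat.clog 2 T), (A.expLen k : ℝ) ≤
      (Finset.Icc 1 (Nat.clog 2 T)).card • (2 * (A.ρ ^ (1 / 3 : ℝ) * (T : ℝ) ^ (2 / 3 : ℝ))) :=
    Finset.sum_le_card_nsmul _ _ _ fun k hk => expLen_le hρ (two_pow_pred_le hk)
  rw [Nat.card_Icc, Nat.add_sub_cancel, nsmul_eq_mul] at h4
  linarith [warmup_le (T := T) hρ]

/-- Regret bound for a realisation in which no confidence bound fails. -/
theorem regret_le (hF : IsNoiseCDF F L b) (hL : 0 ≤ L) (hB : 0 < A.B)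
    (hb : 0 ≤ b) (hρ : 1 ≤ A.ρ) (hδ : 0 < A.δ) (hδ2 : A.δ < 1 / 2) (hT : 2 ≤ T)
    (hrun : A.IsRun tr) (hv0 : ∀ x, 0 ≤ vstar x) (hvB : ∀ x, vstar x ≤ A.B - b)
    (hunif : ∀ t, tr.unif t ∈ Set.Ioo 0 A.B)
    (hgood : ∀ k ∈ Finset.Icc 1 (Nat.clog 2 T), A.kStar ≤ k → A.Concentrated F vstar tr k ∧
      ∀ x, |A.vHat tr k x - vstar x| ≤ predError A k)
    {p : ℕ → ℝ} (hp : ∀ t, 0 ≤ p t) :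
    ∑ t ∈ Finset.Icc 1 T,
        (rev F (vstar (tr.ctx t)) (p t) - rev F (vstar (tr.ctx t)) (tr.price t)) ≤
      (7 * A.B + 3 * ucbConst A.B L) * Real.log (T / A.δ) ^ 3 * A.ρ ^ (1 / 3 : ℝ) *
        (T : ℝ) ^ (2 / 3 : ℝ) := by
  classical
  obtain ⟨h4, hΛ⟩ := one_le_log_div hT hδ hδ2
  have hK := natCeil_logb_two_le hT hδ hδ2
  rw [show (2 : ℝ) = ((2 : ℕ) : ℝ) by norm_num, Real.natCeil_logb_natCast] at hK
  set Λ := Real.log (T / A.δ) with hΛdef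
  set Q := A.ρ ^ (1 / 3 : ℝ) * (T : ℝ) ^ (2 / 3 : ℝ) with hQ
  have hQ0 : 0 ≤ Q := by positivity
  have hC0 : 0 ≤ ucbConst A.B L := by
    unfold ucbConst
    positivity
  set K := Nat.clog 2 T with hKdef
  rw [← Finset.sum_filter_not_add_sum_filter (Finset.Icc 1 T) A.InUCB]
  have hexp : ∑ t ∈ (Finset.Icc 1 T).filter (fun t => ¬ A.InUCB t),
      (rev F (vstar (tr.ctx t)) (p t) - rev F (vstar (tr.ctx t)) (tr.price t)) ≤
      (1 + 2 * K) * Q * A.B := by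
    refine (Finset.sum_le_card_nsmul _ _ A.B fun t ht => ?_).trans ?_
    · rw [Finset.mem_filter, Finset.mem_Icc] at ht
      have h1 := hF.rev_le hB.le (hvB (tr.ctx t)) (hp t)
      have h2 : 0 ≤ rev F (vstar (tr.ctx t)) (tr.price t) := by
        rw [(hrun t ht.1.1).1 ht.2]
        exact hF.rev_nonneg (hunif t).1.le
      linarith
    · rw [nsmul_eq_mul]
      exact mul_le_mul_of_nonneg_right (card_explore_le hρ) hB.le
  have hucb : ∑ t ∈ (Finset.Icc 1 T).filter (fun t => A.InUCB t),
      (rev F (vstar (tr.ctx t)) (p t) - rev F (vstar (tr.ctx t)) (tr.price t)) ≤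
      K * (ucbConst A.B L * Λ ^ 2 * Q) := by
    have hmaps : ∀ t ∈ (Finset.Icc 1 T).filter (fun t => A.InUCB t),
        episode t ∈ Finset.Icc 1 K := by
      intro t ht
      rw [Finset.mem_filter, Finset.mem_Icc] at ht
      exact Finset.mem_Icc.2 ⟨ht.2.mem_ucbRounds.1, Nat.clog_mono_right 2 ht.1.2⟩
    rw [← Finset.sum_fiberwise_of_maps_to hmaps]
    refine (Finset.sum_le_card_nsmul _ _ (ucbConst A.B L * Λ ^ 2 * Q) fun k hk => ?_).trans ?_
    · by_cases hks : A.kStar ≤ k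
      · obtain ⟨hc, hv⟩ := hgood k hk hks
        refine hc.sum_regret_le hF hL hB hb hρ hδ hδ2 hT hrun (Finset.mem_Icc.1 hk).1 hks
          (two_pow_pred_le hk) hv0 hvB hv hp fun t ht => ?_
        simp only [Finset.mem_filter] at ht
        exact ht.2 ▸ ht.1.2.mem_ucbRounds.2.2
      · rw [Finset.sum_eq_zero]
        · positivity
        · intro t ht
          simp only [Finset.mem_filter] at ht
          exact absurd (ht.2 ▸ ht.1.2.mem_ucbRounds.2.1) hks
    · rw [Nat.card_Icc, Nat.add_sub_cancel, nsmul_eq_mul]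
  have hΛ3 : Λ ≤ Λ ^ 3 := by
    simpa using pow_le_pow_right₀ hΛ (show 1 ≤ 3 by norm_num)
  -- The number of episodes is at most `3Λ`; this factor raises the logarithmic power of the UCB
  -- phases from `2` to `3`.
  have h5 : (1 + 2 * K) * Q * A.B ≤ 7 * A.B * (Λ ^ 3 * Q) := by
    calc (1 + 2 * K) * Q * A.B ≤ (7 * Λ ^ 3) * Q * A.B := by
          gcongr
          linarith
      _ = 7 * A.B * (Λ ^ 3 * Q) := by ring
  have h6 : K * (ucbConst A.B L * Λ ^ 2 * Q) ≤ 3 * ucbConst A.B L * (Λ ^ 3 * Q) := by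
    calc K * (ucbConst A.B L * Λ ^ 2 * Q) ≤ (3 * Λ) * (ucbConst A.B L * Λ ^ 2 * Q) := by gcongr
      _ = 3 * ucbConst A.B L * (Λ ^ 3 * Q) := by ring
  calc _ ≤ (1 + 2 * K) * Q * A.B + K * (ucbConst A.B L * Λ ^ 2 * Q) := add_le_add hexp hucb
    _ ≤ 7 * A.B * (Λ ^ 3 * Q) + 3 * ucbConst A.B L * (Λ ^ 3 * Q) := add_le_add h5 h6
    _ = _ := by rw [hQ]; ring

end Regret

/-! ### Assembly: noise distribution and union bound over the episodes -/

theorem isNoiseCDF_cdf {ν : Measure ℝ} [IsProbabilityMeasure ν] {L b : ℝ}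
    (hb : ∀ᵐ e ∂ν, |e| ≤ b) (hlip : ∀ x y : ℝ, |cdf ν x - cdf ν y| ≤ L * |x - y|) :
    IsNoiseCDF (cdf ν) L b where
  mono := monotone_cdf ν
  nonneg := cdf_nonneg ν
  le_one := cdf_le_one ν
  eq_one x hx := by
    have h : ∀ᵐ e ∂ν, e ∈ Set.Iic x := hb.mono fun e he => (le_abs_self e).trans (he.trans hx)
    rw [cdf_eq_real, measureReal_def, (mem_ae_iff_prob_eq_one measurableSet_Iic).1 h,
      ENNReal.toReal_one]
  lip := hlip

/-- Only subadditivity enters, so the event need not be measurable. -/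
theorem ofReal_one_sub_le_measure {Ω : Type*} [MeasurableSpace Ω] {P : Measure Ω}
    [IsProbabilityMeasure P] {s : Set Ω} {x : ℝ} (hx : 0 ≤ x) (h : P sᶜ ≤ ENNReal.ofReal x) :
    ENNReal.ofReal (1 - x) ≤ P s := by
  rw [ENNReal.ofReal_sub 1 hx, ENNReal.ofReal_one, tsub_le_iff_right]
  calc (1 : ENNReal) = P (s ∪ sᶜ) := by rw [Set.union_compl_self, measure_univ]
    _ ≤ P s + P sᶜ := measure_union_le _ _
    _ ≤ P s + ENNReal.ofReal x := add_le_add le_rfl h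

theorem expLen_pos {X : Type*} {A : AlgInput X} (hρ : 1 ≤ A.ρ) (k : ℕ) : 0 < A.expLen k := by
  refine lt_min (Nat.two_pow_pos _) (Nat.ceil_pos.2 ?_)
  have : (0 : ℝ) < ell k := by exact_mod_cast Nat.two_pow_pos _
  positivity

end DynPricing

theorem mainTheorem1 :
    ∃ m : ℕ, ∀ B L : ℝ, 0 < B → 0 < L → ∃ C : ℝ, 0 < C ∧
      ∀ (d₀ : ℕ) (𝒳 : Set (EuclideanSpace ℝ (Fin d₀))) (𝒱 : Set (𝒳 → ℝ)) (vstar : 𝒳 → ℝ)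
        (μX : Measure 𝒳) (ν : Measure ℝ) (Bε : ℝ)
        (ρ : ℝ → ℝ) (oracle : ℝ → (n : ℕ) → (Fin n → 𝒳 × Bool) → 𝒳 → ℝ)
        (T : ℕ) (δ : ℝ)
        (Ω : Type*) (_ : MeasurableSpace Ω) (P : Measure Ω)
        (ε : ℕ → Ω → ℝ) (tr : Ω → DynPricing.Trajectory 𝒳) (pstar : ℕ → Ω → ℝ),
        IsProbabilityMeasure μX → IsProbabilityMeasure ν → IsProbabilityMeasure P →
        Measurable vstar →
        -- realizability
        vstar ∈ 𝒱 →
        -- bounded valuations, centred bounded noise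
        0 < Bε → (∀ᵐ e ∂ν, |e| ≤ Bε) → ∫ e, e ∂ν = 0 →
        (∀ x, Bε ≤ vstar x ∧ vstar x ≤ B - Bε) →
        -- Lipschitz noise distribution
        (∀ a b : ℝ, |cdf ν a - cdf ν b| ≤ L * |a - b|) →
        -- offline regression oracle
        DynPricing.OracleMeasurable oracle →
        DynPricing.IsOfflineRegressionOracle B μX vstar 𝒱 ρ oracle →
        2 ≤ T → 0 < δ → δ < 1 / (2 * (⌈Real.logb 2 (T : ℝ)⌉₊ : ℝ)) → 1 ≤ ρ δ →
        -- the model, and the algorithm run in it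
        DynPricing.IsPricingModel P B μX ν vstar ε tr →
        (∀ ω, DynPricing.AlgInput.IsRun
          { B := B, δ := δ, ρ := ρ δ, oracle := oracle δ } (tr ω)) →
        -- optimal prices
        (∀ t ω, 0 ≤ pstar t ω ∧
          IsMaxOn (DynPricing.rev (cdf ν) (vstar ((tr ω).ctx t))) (Set.Ici 0) (pstar t ω)) →
        ENNReal.ofReal (1 - 2 * δ * (⌈Real.logb 2 (T : ℝ)⌉₊ : ℝ)) ≤
          P {ω | ∑ t ∈ Finset.Icc 1 T,
              (DynPricing.rev (cdf ν) (vstar ((tr ω).ctx t)) (pstar t ω) -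
                DynPricing.rev (cdf ν) (vstar ((tr ω).ctx t)) ((tr ω).price t)) ≤
            C * Real.log (T / δ) ^ m * (ρ δ) ^ (1 / 3 : ℝ) * (T : ℝ) ^ (2 / 3 : ℝ)} := by
  refine ⟨3, fun B L hB hL => ⟨7 * B + 3 * DynPricing.ucbConst B L, ?_, ?_⟩⟩
  · unfold DynPricing.ucbConst
    positivity
  intro d₀ 𝒳 𝒱 vstar μX ν Bε ρ oracle T δ Ω _ P ε tr pstar _ _ _ hv _ hBε hbound hmean hvb hlip
    hO hor hT hδ hδK hρ hM hrun hpstar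
  set A : DynPricing.AlgInput 𝒳 := { B := B, δ := δ, ρ := ρ δ, oracle := oracle δ } with hA
  have hOA : A.OracleMeasurableAt := hO δ
  have hK : (⌈Real.logb 2 (T : ℝ)⌉₊ : ℝ) = Nat.clog 2 T := by
    rw [show (2 : ℝ) = ((2 : ℕ) : ℝ) by norm_num, Real.natCeil_logb_natCast]
  have hK1 : (1 : ℝ) ≤ Nat.clog 2 T := by exact_mod_cast Nat.clog_pos (by norm_num) hT
  rw [hK] at hδK ⊢
  have hδ2 : δ < 1 / 2 := by
    rw [lt_div_iff₀ (by positivity)] at hδK ⊢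
    nlinarith
  refine DynPricing.ofReal_one_sub_le_measure (by positivity) ?_
  -- Two failures of probability `δ` in each of at most `⌈log₂ T⌉` episodes make up the `2δ⌈log₂
  -- T⌉`; auxiliary draws outside `(0, B)` form a null event.
  set bad : ℕ → Set Ω := fun k => {ω | ¬ A.Concentrated (cdf ν) vstar (tr ω) k} ∪
    {ω | ¬ ∀ x, |A.vHat (tr ω) k x - vstar x| ≤ DynPricing.predError A k} with hbad
  have hbadk : ∀ k ∈ (Finset.Icc 1 (Nat.clog 2 T)).filter (A.kStar ≤ ·),
      P (bad k) ≤ ENNReal.ofReal (2 * δ) := by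
    intro k hk
    rw [Finset.mem_filter, Finset.mem_Icc] at hk
    have h1 := hM.measure_not_concentrated_le hB hv hOA hrun hL.le hlip hδ (by linarith : A.δ ≤ 1)
      hk.1.1 hk.2
    have h2 := hM.measure_not_predictor_le hB hv hbound hmean hvb hrun hk.1.1
      (hor δ hδ (by linarith) (A.expLen k) (DynPricing.expLen_pos hρ k)).2
    rw [two_mul, ENNReal.ofReal_add hδ.le hδ.le]
    exact (measure_union_le _ _).trans (add_le_add h1 h2)
  have hunif := ae_iff.1 (hM.ae_unif_mem hB)
  refine (measure_mono (t := {ω | ¬ ∀ t, (tr ω).unif t ∈ Set.Ioo 0 B} ∪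
    ⋃ k ∈ (Finset.Icc 1 (Nat.clog 2 T)).filter (A.kStar ≤ ·), bad k) ?_).trans ?_
  · intro ω hω
    by_contra hcon
    simp only [hbad, Set.mem_union, Set.mem_iUnion, Set.mem_ofPred_eq, not_or, not_exists, not_not,
      Finset.mem_filter] at hcon
    refine hω (DynPricing.regret_le (A := A) (DynPricing.isNoiseCDF_cdf hbound hlip) hL.le hB
      hBε.le hρ hδ hδ2 hT (hrun ω) (fun x => hBε.le.trans (hvb x).1) (fun x => (hvb x).2) hcon.1
      (fun k hk hks => hcon.2 k ⟨hk, hks⟩) fun t => (hpstar t ω).1)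
  · refine (measure_union_le _ _).trans ?_
    rw [hunif, zero_add]
    refine (measure_biUnion_finset_le _ _).trans ((Finset.sum_le_card_nsmul _ _ _ hbadk).trans ?_)
    have hcard : ((Finset.Icc 1 (Nat.clog 2 T)).filter (A.kStar ≤ ·)).card ≤ Nat.clog 2 T :=
      (Finset.card_filter_le _ _).trans (by rw [Nat.card_Icc, Nat.add_sub_cancel])
    rw [nsmul_eq_mul, ← ENNReal.ofReal_natCast, ← ENNReal.ofReal_mul (Nat.cast_nonneg _)]
    refine ENNReal.ofReal_le_ofReal ?_
    rw [mul_comm]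
    exact mul_le_mul_of_nonneg_left (by exact_mod_cast hcard) (by positivity)
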